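/- Fix $d\ge 1$, $T>0$ and constants $a,b\in\mathbb R$ with $b\neq 0$. For $n\ge 2$ let $P^{(n)}$ be the law on $C([0,T];\mathbb R^d)^n$ of a weak solution of $$dX^i_t=\Big(aX^i_t+\frac{b}{n-1}\sum_{j\ne i}X^j_t\Big)dt+dW^i_t,\qquad X^i_0=0,\qquad i=1,\dots,n,$$ where $W^1,\dots,W^n$ are independent $d$-dimensional Brownian motions, and let $P^{(n,k)}$ be the marginal law of $(X^1,\dots,X^k)$ for $1\le k\le n$. Let $\mu$ be the law on $C([0,T];\mathbb R^d)$ of a weak solution of the McKean–Vlasov equation $$dX_t=\Big(aX_t+b\int y_t\,\mu(dy)\Big)dt+dW_t,\qquad X_0=0,\qquad \mu=\mathrm{Law}(X),\qquad \int_0^T\!\!\int |y_t|\,\mu(dy)\,dt<\infty .$$ (Both the case $a,b>0$ and the Ornstein–Uhlenbeck case $a,b<0$ are included.) Write $P^{(n,k)}_t$ and $\mu_t$ for the time-$t$ marginals. Let $\mathcal W_2$ be the quadratic Wasserstein distance, defined from the Euclidean norm on $(\mathbb R^d)^k\cong\mathbb R^{dk}$ for time marginals and from the sup-norm $\sup_{t\in[0,T]}|x_t|$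 on $C([0,T];\mathbb R^d)^k\cong C([0,T];\mathbb R^{dk})$ for path laws, and let $H$ be relative entropy. If $1\le k=k_n\le n$ and $k_n/n\to0$ as $n\to\infty$, then $$\liminf_{n\to\infty}\Big(\frac nk\Big)^2\mathcal W_2^2\big(P^{(n,k)}_t,\mu_t^{\otimes k}\big)>0\quad\text{for each }t\in(0,T],\qquad \liminf_{n\to\infty}\Big(\frac nk\Big)^2\mathcal W_2^2\big(P^{(n,k)},\mu^{\otimes k}\big)>0,$$ and also $$\liminf_{n\to\infty}\Big(\frac nk\Big)^2H\big(P^{(n,k)}\,\big|\,\mu^{\otimes k}\big)>0 .$$ Hence neither $\mathcal W_2^2(P^{(n,k)},\mu^{\otimes k})$ nor $H(P^{(n,k)}\,|\,\mu^{\otimes k})$ is $o((k/n)^2)$: the rate $(k/n)^2$ cannot be improved. -/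

import Mathlib

open MeasureTheory ProbabilityTheory Filter Topology
open scoped NNReal ENNReal

universe u v

namespace MeanField

noncomputable section

/-- The path space `C([0,T]; ℝ^d)` with the uniform topology. -/
abbrev PathSpace (d : ℕ) (T : ℝ) : Type :=
  C(Set.Icc (0 : ℝ) T, EuclideanSpace ℝ (Fin d))

instance instMeasurableSpacePathSpace (d : ℕ) (T : ℝ) : MeasurableSpace (PathSpace d T) :=
  borel _

instance instBorelSpacePathSpace (d : ℕ) (T : ℝ) : BorelSpace (PathSpace d T) :=
  ⟨rfl⟩

/-- Lebesgue measure on the time interval `[0,T]`. -/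
def timeMeasure (T : ℝ) : Measure (Set.Icc (0 : ℝ) T) :=
  (volume : Measure ℝ).comap Subtype.val

/-! ### Distances between probability measures -/

/-- The squared quadratic Wasserstein distance for a distance function `ρ`: the infimum of
`∫ ρ(x,y)² π(dx,dy)` over all couplings `π` of `ν` and `ν'`. -/
def wassersteinSq {α : Type*} [MeasurableSpace α] (ρ : α → α → ℝ≥0∞) (ν ν' : Measure α) : ℝ≥0∞ :=
  ⨅ (π : Measure (α × α)) (_ : π.map Prod.fst = ν ∧ π.map Prod.snd = ν'),
    ∫⁻ p, ρ p.1 p.2 ^ 2 ∂π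

/-- The Euclidean distance on `(ℝ^d)^k ≅ ℝ^{dk}`. -/
def configDist {d k : ℕ} (x y : Fin k → EuclideanSpace ℝ (Fin d)) : ℝ≥0∞ :=
  edist (WithLp.toLp 2 x) (WithLp.toLp 2 y)

/-- The uniform distance on `C([0,T]; ℝ^d)^k ≅ C([0,T]; ℝ^{dk})`, where `ℝ^{dk}` is Euclidean. -/
def pathDist {d k : ℕ} {T : ℝ} (x y : Fin k → PathSpace d T) : ℝ≥0∞ :=
  ⨆ t : Set.Icc (0 : ℝ) T, configDist (fun i => x i t) (fun i => y i t)

/-! ### Marginals -/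

/-- The marginal law of the first `k` out of `n` coordinates. -/
def firstMarginal {α : Type*} [MeasurableSpace α] {k n : ℕ} (h : k ≤ n)
    (P : Measure (Fin n → α)) : Measure (Fin k → α) :=
  P.map fun x i => x (Fin.castLE h i)

/-- The law at time `t` of `k` particles whose trajectories have joint law `P`. -/
def timeMarginal {d k : ℕ} {T : ℝ} (t : Set.Icc (0 : ℝ) T) (P : Measure (Fin k → PathSpace d T)) :
    Measure (Fin k → EuclideanSpace ℝ (Fin d)) :=
  P.map fun x i => x i t

/-! ### Stochastic differential equations with additive noise -/

section SDE

variable {d n : ℕ} {T : ℝ} {Ω : Type*} {mΩ : MeasurableSpace Ω}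

/-- `W = (W^1, …, W^n)` is a family of `n` independent `d`-dimensional Brownian motions on `[0,T]`
relative to the filtration `𝓕`. -/
structure IsBrownianMotion (𝓕 : Filtration (Set.Icc (0 : ℝ) T) mΩ) (Pr : Measure Ω)
    (W : Ω → Fin n → PathSpace d T) : Prop where
  adapted : ∀ t, Measurable[𝓕 t] fun ω i => W ω i t
  start : ∀ᵐ ω ∂Pr, ∀ i, ∀ t : Set.Icc (0 : ℝ) T, (t : ℝ) = 0 → W ω i t = 0
  increment_law : ∀ s t : Set.Icc (0 : ℝ) T, s ≤ t →
    HasLaw (fun ω (i : Fin n) (j : Fin d) => W ω i t j - W ω i s j)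
      (Measure.pi fun _ => Measure.pi fun _ => gaussianReal 0 (Real.toNNReal ((t : ℝ) - s))) Pr
  increment_indep : ∀ s t : Set.Icc (0 : ℝ) T, s ≤ t →
    Indep (MeasurableSpace.comap
      (fun ω (i : Fin n) (j : Fin d) => W ω i t j - W ω i s j) inferInstance) (𝓕 s) Pr

/-- `X` solves `dX^i_t = β^i(t,X) dt + dW^i_t`, `i = 1, …, n`, on `[0,T]`, for a Brownian motion `W`
relative to a filtration `𝓕` to which `X` is adapted. -/
structure IsWeakSolution
    (β : Set.Icc (0 : ℝ) T → (Fin n → PathSpace d T) → Fin n → EuclideanSpace ℝ (Fin d))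
    (𝓕 : Filtration (Set.Icc (0 : ℝ) T) mΩ) (Pr : Measure Ω)
    (X W : Ω → Fin n → PathSpace d T) : Prop where
  brownian : IsBrownianMotion 𝓕 Pr W
  adapted : ∀ t, Measurable[𝓕 t] fun ω i => X ω i t
  equation : ∀ᵐ ω ∂Pr, ∀ i, ∀ s t : Set.Icc (0 : ℝ) T, s ≤ t →
    X ω i t - X ω i s = (∫ r in Set.Ioc s t, β r (X ω) i ∂timeMeasure T) + (W ω i t - W ω i s)

end SDE

/-- `P` is the law on `C([0,T]; ℝ^d)^n` of a weak solution of the `n`-particle system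
`dX^i_t = (b₀(t,X^i) + (n-1)⁻¹ ∑_{j ≠ i} b(t,X^i,X^j)) dt + dW^i_t`, `i = 1, …, n`,
where the drift is required to be absolutely integrable in time, almost surely. -/
def IsParticleLaw {d n : ℕ} {T : ℝ}
    (b₀ : Set.Icc (0 : ℝ) T → PathSpace d T → EuclideanSpace ℝ (Fin d))
    (b : Set.Icc (0 : ℝ) T → PathSpace d T → PathSpace d T → EuclideanSpace ℝ (Fin d))
    (P : Measure (Fin n → PathSpace d T)) : Prop :=
  ∃ (Ω : Type u) (mΩ : MeasurableSpace Ω) (Pr : Measure Ω)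
    (𝓕 : Filtration (Set.Icc (0 : ℝ) T) mΩ) (X W : Ω → Fin n → PathSpace d T),
    IsProbabilityMeasure Pr ∧
    IsWeakSolution
      (fun t x i => b₀ t (x i) + (1 / ((n : ℝ) - 1)) • ∑ j ∈ Finset.univ.erase i, b t (x i) (x j))
      𝓕 Pr X W ∧
    (∀ᵐ ω ∂Pr, ∀ i, ∫⁻ t, (‖b₀ t (X ω i)‖ₑ + ENNReal.ofReal (1 / ((n : ℝ) - 1)) *
      ∑ j ∈ Finset.univ.erase i, ‖b t (X ω i) (X ω j)‖ₑ) ∂timeMeasure T < ∞) ∧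
    HasLaw X P Pr

/-- `μ` is the law on `C([0,T]; ℝ^d)` of a weak solution of the McKean–Vlasov equation
`dX_t = (b₀(t,X) + ∫ b(t,X,y) μ(dy)) dt + dW_t`, `μ = Law(X)`,
where the drift is required to be absolutely integrable in time, almost surely. -/
def IsMcKeanVlasovLaw {d : ℕ} {T : ℝ}
    (b₀ : Set.Icc (0 : ℝ) T → PathSpace d T → EuclideanSpace ℝ (Fin d))
    (b : Set.Icc (0 : ℝ) T → PathSpace d T → PathSpace d T → EuclideanSpace ℝ (Fin d))
    (μ : Measure (PathSpace d T)) : Prop :=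
  ∃ (Ω : Type u) (mΩ : MeasurableSpace Ω) (Pr : Measure Ω)
    (𝓕 : Filtration (Set.Icc (0 : ℝ) T) mΩ) (X W : Ω → Fin 1 → PathSpace d T),
    IsProbabilityMeasure Pr ∧
    IsWeakSolution (fun t x i => b₀ t (x i) + ∫ y, b t (x i) y ∂μ) 𝓕 Pr X W ∧
    (∀ᵐ ω ∂Pr, ∫⁻ t, (‖b₀ t (X ω 0)‖ₑ + ∫⁻ y, ‖b t (X ω 0) y‖ₑ ∂μ) ∂timeMeasure T < ∞) ∧
    HasLaw (fun ω => X ω 0) μ Pr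

end

end MeanField

namespace MeanField

/-! Everything reduces to variances of one real Gaussian functional. Fix `t > 0`, a coordinate `j`
and a unit vector `c`, and test with `∑ cᵢ xᵢ(t)ⱼ`, which is 1-Lipschitz for both transport costs.
Write `v(r) = ouVar r t`. Under `μ^{⊗k}` the functional is centred Gaussian with variance `v(a)`:
the mean-field term vanishes because the mean solves a homogeneous linear equation from zero. Under
the particle law it is centred Gaussian with variance `s = (∑c)²/n · v(a+b) + (1 - (∑c)²/n) · v(a -
b/(n-1))`, because the system decouples into the mean mode (rate `a+b`) and the mean-zero modes
(rate `a - b/(n-1)`). Wiener integrals of smooth deterministic integrands are handled pathwise, by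
integration by parts.

A variance gap `s - v(a)` costs at least a constant times `(s - v(a))²`, both in squared transport
distance (`ofReal_le_wassersteinSq`) and in entropy (`ofReal_le_klDiv`). It remains to find `c` with
`|s - v(a)|` of order `k/n`. With `c = k^{-1/2}(1,…,1)`, `(n/k)(s - v(a))` equals `p + e/k`, where
`p = v(a+b) - v(a - b/(n-1))` tends to `D = v(a+b) - v(a) ≠ 0` and `e = n(v(a - b/(n-1)) - v(a))`
tends to `-β = -b v'(a)`. For `k = 1` the limit `D - β` is positive by strict convexity of `v`. For
`k ≥ 2` and `b < 0` the two terms may cancel; then `e/k` alone is not small, and `c =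
2^{-1/2}(1,-1,0,…)` detects exactly that term (`exists_unit_vector_discrepancy`). -/

/-! ### Gaussian laws under linear combinations and almost sure limits. -/

lemma hasLaw_sum_mul_pi {ι α : Type*} [Fintype ι] [MeasurableSpace α] {μ : Measure α}
    [IsProbabilityMeasure μ] {g : α → ℝ} {v : ℝ} (hv : 0 ≤ v)
    (hg : HasLaw g (gaussianReal 0 v.toNNReal) μ) (c : ι → ℝ) :
    HasLaw (fun x : ι → α => ∑ i, c i * g (x i))
      (gaussianReal 0 (Real.toNNReal ((∑ i, c i ^ 2) * v))) (Measure.pi fun _ => μ) := by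
  have hm : ∀ i : ι, AEMeasurable (fun x : ι → α => c i * g (x i)) (Measure.pi fun _ => μ) :=
    fun i => (hg.aemeasurable.comp_quasiMeasurePreserving
      (Measure.quasiMeasurePreserving_eval _ i)).const_mul _
  have hlaw : ∀ i : ι, HasLaw (fun x : ι → α => c i * g (x i))
      (gaussianReal (c i * 0) (NNReal.mk (c i ^ 2) (sq_nonneg _) * v.toNNReal))
      (Measure.pi fun _ => μ) := fun i => by
    refine gaussianReal_const_mul (X := fun x : ι → α => g (x i)) ?_ (c i)
    exact hg.fun_comp (measurePreserving_eval (fun _ : ι => μ) i).hasLaw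
  refine ⟨by fun_prop, ?_⟩
  have hind : iIndepFun (fun (i : ι) (x : ι → α) => c i * g (x i)) (Measure.pi fun _ => μ) :=
    iIndepFun_pi (X := fun i y => c i * g y) fun i => hg.aemeasurable.const_mul _
  have : IsProbabilityMeasure
      ((Measure.pi fun _ : ι => μ).map fun x : ι → α => ∑ i, c i * g (x i)) :=
    Measure.isProbabilityMeasure_map (by fun_prop)
  refine Measure.ext_of_charFun ?_
  rw [iIndepFun.charFun_map_fun_sum_eq_prod hm hind]
  ext ξ
  have h0 : 0 ≤ (∑ i, c i ^ 2) * v := mul_nonneg (Finset.sum_nonneg fun i _ => sq_nonneg _) hv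
  simp only [Finset.prod_apply, (hlaw _).map_eq, charFun_gaussianReal, ← Complex.exp_sum]
  congr 1
  rw [Real.coe_toNNReal _ h0]
  simp [Real.coe_toNNReal _ hv, Finset.sum_mul, Finset.sum_div]

/-- Characteristic functions converge by dominated convergence, and the Gaussian ones depend
continuously on the variance. Zero variance is allowed. -/
lemma hasLaw_gaussianReal_of_tendsto {Ω : Type*} {mΩ : MeasurableSpace Ω} {Pr : Measure Ω}
    [IsProbabilityMeasure Pr] {Y : ℕ → Ω → ℝ} {Z : Ω → ℝ} {v : ℕ → ℝ} {v' : ℝ}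
    (hv : ∀ N, 0 ≤ v N)
    (hY : ∀ N, HasLaw (Y N) (gaussianReal 0 (v N).toNNReal) Pr)
    (hYZ : ∀ᵐ ω ∂Pr, Tendsto (fun N => Y N ω) atTop (𝓝 (Z ω)))
    (hvv : Tendsto v atTop (𝓝 v')) :
    HasLaw Z (gaussianReal 0 v'.toNNReal) Pr := by
  have hZ : AEMeasurable Z Pr := aemeasurable_of_tendsto_metrizable_ae' (fun N => (hY N).aemeasurable) hYZ
  have hv' : 0 ≤ v' := ge_of_tendsto' hvv hv
  refine ⟨hZ, ?_⟩
  have : IsProbabilityMeasure (Pr.map Z) := Measure.isProbabilityMeasure_map hZ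
  refine Measure.ext_of_charFun ?_
  ext ξ
  have hint : ∀ V : Ω → ℝ, AEMeasurable V Pr →
      charFun (Pr.map V) ξ = ∫ ω, Complex.exp (ξ * V ω * Complex.I) ∂Pr := fun V hV => by
    rw [charFun_apply_real, integral_map hV (by fun_prop)]
  have h1 : Tendsto (fun N => charFun (Pr.map (Y N)) ξ) atTop (𝓝 (charFun (Pr.map Z) ξ)) := by
    simp only [hint _ (hY _).aemeasurable, hint _ hZ]
    refine tendsto_integral_of_dominated_convergence (fun _ => 1) (fun N => ?_)
      (integrable_const _) (fun N => ae_of_all _ fun ω => ?_) ?_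
    · have := (hY N).aemeasurable
      exact (by fun_prop : AEMeasurable _ Pr).aestronglyMeasurable
    · rw [← Complex.ofReal_mul, Complex.norm_exp_ofReal_mul_I]
    · filter_upwards [hYZ] with ω hω
      have : Continuous fun x : ℝ => Complex.exp (ξ * x * Complex.I) := by fun_prop
      exact (this.tendsto _).comp hω
  have h2 : Tendsto (fun N => charFun (Pr.map (Y N)) ξ) atTop
      (𝓝 (charFun (gaussianReal 0 v'.toNNReal) ξ)) := by
    simp only [(hY _).map_eq, charFun_gaussianReal, Real.coe_toNNReal _ (hv _),
      Real.coe_toNNReal _ hv']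
    have : Continuous fun x : ℝ =>
        Complex.exp (ξ * (0 : ℝ) * Complex.I - x * (ξ : ℂ) ^ 2 / 2) := by fun_prop
    exact (this.tendsto _).comp hvv
  exact tendsto_nhds_unique h1 h2

/-! ### Weighted sums of Brownian increments. -/

section Brownian

variable {d n : ℕ} {T : ℝ} {Ω : Type*} {mΩ : MeasurableSpace Ω}
  {𝓕 : Filtration (Set.Icc (0 : ℝ) T) mΩ} {Pr : Measure Ω} {W : Ω → Fin n → PathSpace d T}

lemma IsBrownianMotion.hasLaw_sum_mul_increment (hW : IsBrownianMotion 𝓕 Pr W) (j : Fin d)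
    {s t : Set.Icc (0 : ℝ) T} (hst : s ≤ t) (c : Fin n → ℝ) :
    HasLaw (fun ω => ∑ i, c i * (W ω i t j - W ω i s j))
      (gaussianReal 0 (Real.toNNReal ((∑ i, c i ^ 2) * ((t : ℝ) - s)))) Pr := by
  have h := hasLaw_sum_mul_pi (ι := Fin n) (sub_nonneg.2 (Subtype.coe_le_coe.2 hst))
    (measurePreserving_eval (fun _ : Fin d => gaussianReal 0 (Real.toNNReal ((t : ℝ) - s))) j).hasLaw c
  exact h.fun_comp (hW.increment_law s t hst)

lemma IsBrownianMotion.measurable_coord (hW : IsBrownianMotion 𝓕 Pr W) (i : Fin n) (j : Fin d)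
    {s t : Set.Icc (0 : ℝ) T} (hst : s ≤ t) : Measurable[𝓕 t] fun ω => W ω i s j := by
  have h := (hW.adapted s).mono (𝓕.mono hst) le_rfl
  exact (by fun_prop : Measurable fun x : Fin n → EuclideanSpace ℝ (Fin d) => x i j).comp h

/-- Induction on the number of steps: the sum so far is `𝓕 (τ m)`-measurable, hence independent of
the next increment, and variances add. -/
lemma IsBrownianMotion.hasLaw_sum_sum_mul_increment [IsProbabilityMeasure Pr]
    (hW : IsBrownianMotion 𝓕 Pr W) (j : Fin d)
    {τ : ℕ → Set.Icc (0 : ℝ) T} (hτ : Monotone τ) (F : ℕ → Fin n → ℝ) (m : ℕ) :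
    HasLaw (fun ω => ∑ l ∈ Finset.range m, ∑ i, F l i * (W ω i (τ (l + 1)) j - W ω i (τ l) j))
      (gaussianReal 0 (Real.toNNReal
        (∑ l ∈ Finset.range m, (∑ i, F l i ^ 2) * ((τ (l + 1) : ℝ) - τ l)))) Pr := by
  have hnn : ∀ l, 0 ≤ (∑ i, F l i ^ 2) * ((τ (l + 1) : ℝ) - τ l) := fun l =>
    mul_nonneg (Finset.sum_nonneg fun i _ => sq_nonneg _)
      (sub_nonneg.2 (Subtype.coe_le_coe.2 (hτ l.le_succ)))
  induction m with
  | zero => simpa using hasLaw_dirac_of_ae_eq (P := Pr) (x := (0 : ℝ)) (X := fun _ => 0) (by rfl)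
  | succ m ih =>
    have hinc := hW.hasLaw_sum_mul_increment j (hτ m.le_succ) (F m)
    have hmeas : Measurable[𝓕 (τ m)] fun ω =>
        ∑ l ∈ Finset.range m, ∑ i, F l i * (W ω i (τ (l + 1)) j - W ω i (τ l) j) := by
      refine Finset.measurable_fun_sum _ fun l hl => Finset.measurable_fun_sum _ fun i _ => ?_
      have hl' := Finset.mem_range.1 hl
      exact ((hW.measurable_coord i j (hτ hl')).sub
        (hW.measurable_coord i j (hτ hl'.le))).const_mul _
    have hind : IndepFun
        (fun ω => ∑ l ∈ Finset.range m, ∑ i, F l i * (W ω i (τ (l + 1)) j - W ω i (τ l) j))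
        (fun ω => ∑ i, F m i * (W ω i (τ (m + 1)) j - W ω i (τ m) j)) Pr := by
      refine (indep_of_indep_of_le_left (indep_of_indep_of_le_right
        (hW.increment_indep (τ m) (τ (m + 1)) (hτ m.le_succ)) hmeas.comap_le) ?_).symm
      refine Measurable.comap_le ?_
      refine (by fun_prop : Measurable fun x : Fin n → Fin d → ℝ =>
        ∑ i, F m i * x i j).comp (comap_measurable _)
    have hadd := gaussianReal_add_gaussianReal_of_indepFun hind ih.map_eq hinc.map_eq
    simp only [Finset.sum_range_succ]
    refine ⟨ih.aemeasurable.add hinc.aemeasurable, ?_⟩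
    rw [Real.toNNReal_add (Finset.sum_nonneg fun l _ => hnn l) (hnn m)]
    rw [add_zero] at hadd
    exact hadd

end Brownian

/-! ### Riemann and Stieltjes sums. -/

/-- Uniform continuity of `g` on `[0,t]` controls each cell. The parameter `e` selects the left
(`0`) or right (`1`) endpoint: the left one serves the variance, the right one the summation by
parts. -/
lemma tendsto_riemannSum_mul {g h : ℝ → ℝ} (hg : Continuous g) (hh : Continuous h) {t : ℝ}
    (ht : 0 ≤ t) (e : ℕ) (he : e ≤ 1) :
    Tendsto (fun N : ℕ => ∑ l ∈ Finset.range N,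
      g (((l + e : ℕ) : ℝ) * t / N) * ∫ s in ((l : ℕ) : ℝ) * t / N..((l + 1 : ℕ) : ℝ) * t / N, h s)
      atTop (𝓝 (∫ s in (0 : ℝ)..t, g s * h s)) := by
  obtain ⟨C, hC⟩ := (isCompact_Icc (a := (0 : ℝ)) (b := t)).exists_bound_of_continuousOn hh.continuousOn
  have hC0 : 0 ≤ C := (norm_nonneg _).trans (hC 0 ⟨le_rfl, ht⟩)
  have hunif := isCompact_Icc.uniformContinuousOn_of_continuous (s := Set.Icc 0 t) hg.continuousOn
  rw [Metric.tendsto_atTop]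
  intro ε hε
  have hη : 0 < ε / (C * t + 1) := by positivity
  obtain ⟨δ, hδ, hδ'⟩ := Metric.uniformContinuousOn_iff.1 hunif _ hη
  obtain ⟨N₀, hN₀⟩ := exists_nat_gt (t / δ)
  refine ⟨N₀ + 1, fun N hN => ?_⟩
  have hNpos : (0 : ℝ) < N := by exact_mod_cast (by omega : 0 < N)
  have hNδ : t / N < δ := by
    rw [div_lt_iff₀ hNpos]
    rw [div_lt_iff₀ hδ] at hN₀
    have : (N₀ : ℝ) ≤ N := by exact_mod_cast (by omega : N₀ ≤ N)
    nlinarith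
  have hstep : ∀ l : ℕ, ((l + 1 : ℕ) : ℝ) * t / N - (l : ℝ) * t / N = t / N := fun l => by
    push_cast; ring
  have hstep0 : 0 ≤ t / N := by positivity
  have hmem : ∀ l : ℕ, l ≤ N → (l : ℝ) * t / N ∈ Set.Icc 0 t := fun l hl => by
    refine ⟨by positivity, ?_⟩
    rw [div_le_iff₀ hNpos, mul_comm]
    exact mul_le_mul_of_nonneg_left (by exact_mod_cast hl) ht
  have hgh : Continuous fun s => g s * h s := hg.mul hh
  have hsum : ∫ s in (0 : ℝ)..t, g s * h s = ∑ l ∈ Finset.range N,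
      ∫ s in ((l : ℕ) : ℝ) * t / N..((l + 1 : ℕ) : ℝ) * t / N, g s * h s := by
    rw [intervalIntegral.sum_integral_adjacent_intervals (a := fun l : ℕ => (l : ℝ) * t / N)
      fun k _ => hgh.intervalIntegrable _ _]
    simp [mul_div_cancel_left₀ t hNpos.ne']
  have hbound : ∀ l ∈ Finset.range N,
      ‖g (((l + e : ℕ) : ℝ) * t / N) * (∫ s in ((l : ℕ) : ℝ) * t / N..((l + 1 : ℕ) : ℝ) * t / N, h s)
        - ∫ s in ((l : ℕ) : ℝ) * t / N..((l + 1 : ℕ) : ℝ) * t / N, g s * h s‖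
      ≤ ε / (C * t + 1) * C * (t / N) := fun l hl => by
    have hl' := Finset.mem_range.1 hl
    rw [← intervalIntegral.integral_const_mul, ← intervalIntegral.integral_sub
      ((hh.intervalIntegrable _ _).const_mul _) (hgh.intervalIntegrable _ _)]
    have hle : (l : ℝ) * t / N ≤ ((l + 1 : ℕ) : ℝ) * t / N := by linarith [hstep l]
    refine (intervalIntegral.norm_integral_le_of_norm_le_const (C := ε / (C * t + 1) * C)
      fun s hs => ?_).trans ?_
    · rw [Set.uIoc_of_le hle] at hs
      have h1 := hmem l hl'.le
      have h2 := hmem (l + 1) hl'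
      have hsm : s ∈ Set.Icc 0 t := ⟨h1.1.trans hs.1.le, hs.2.trans h2.2⟩
      have hp := hmem (l + e) (by omega)
      have hd : dist (((l + e : ℕ) : ℝ) * t / N) s < δ := by
        rw [Real.dist_eq, abs_lt]
        have h3 : (l : ℝ) * t / N ≤ ((l + e : ℕ) : ℝ) * t / N := by
          gcongr; omega
        have h4 : ((l + e : ℕ) : ℝ) * t / N ≤ ((l + 1 : ℕ) : ℝ) * t / N := by
          gcongr
        have := hstep l
        exact ⟨by linarith [hs.2], by linarith [hs.1]⟩
      rw [← sub_mul, norm_mul]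
      exact mul_le_mul (hδ' _ hp _ hsm hd).le (hC s hsm) (norm_nonneg _) hη.le
    · rw [hstep l, abs_of_nonneg hstep0]
  rw [dist_eq_norm, hsum, ← Finset.sum_sub_distrib]
  refine (norm_sum_le_of_le _ hbound).trans_lt ?_
  rw [Finset.sum_const, Finset.card_range, nsmul_eq_mul]
  have : (N : ℝ) * (ε / (C * t + 1) * C * (t / N)) = ε * ((C * t) / (C * t + 1)) := by
    field_simp
  rw [this]
  have : C * t / (C * t + 1) < 1 := by rw [div_lt_one (by positivity)]; linarith
  nlinarith

/-- Summation by parts: adding the right-endpoint sum of `w` against increments of `f` makes the sum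
telescope to `f t * w t`. No bounded variation of `w` is needed, so this applies to Brownian paths.
-/
lemma tendsto_stieltjesSum {f f' w : ℝ → ℝ} (hf : ∀ s, HasDerivAt f (f' s) s)
    (hf' : Continuous f') (hw : Continuous w) (hw0 : w 0 = 0) {t : ℝ} (ht : 0 ≤ t) :
    Tendsto (fun N : ℕ => ∑ l ∈ Finset.range N,
      f ((l : ℝ) * t / N) * (w (((l + 1 : ℕ) : ℝ) * t / N) - w ((l : ℝ) * t / N)))
      atTop (𝓝 (f t * w t - ∫ s in (0 : ℝ)..t, w s * f' s)) := by
  have h := (tendsto_riemannSum_mul hw hf' ht 1 le_rfl).const_sub (f t * w t)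
  refine h.congr' ?_
  filter_upwards [eventually_gt_atTop 0] with N hN
  have hNpos : (N : ℝ) ≠ 0 := by exact_mod_cast hN.ne'
  have hI : ∀ x y : ℝ, ∫ s in x..y, f' s = f y - f x := fun x y =>
    intervalIntegral.integral_eq_sub_of_hasDerivAt (fun s _ => hf s) (hf'.intervalIntegrable _ _)
  simp only [hI]
  rw [sub_eq_iff_eq_add, ← Finset.sum_add_distrib]
  have htel := Finset.sum_range_sub (fun l : ℕ => f ((l : ℝ) * t / N) * w ((l : ℝ) * t / N)) N
  simp only [mul_div_cancel_left₀ t hNpos, Nat.cast_zero, zero_mul, zero_div, hw0, mul_zero,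
    sub_zero] at htel
  rw [← htel]
  refine Finset.sum_congr rfl fun l _ => ?_
  ring

/-- A continuous path on `[0,T]`, extended to `ℝ` by its boundary values, in coordinate `j`. -/
noncomputable def extendCoord {d : ℕ} {T : ℝ} (hT : 0 ≤ T) (x : PathSpace d T) (j : Fin d) (s : ℝ) : ℝ :=
  x (Set.projIcc 0 T hT s) j

/-! ### Wiener integrals of smooth deterministic integrands. -/

section Wiener

variable {d n : ℕ} {T : ℝ}

lemma continuous_extendCoord (hT : 0 ≤ T) (x : PathSpace d T) (j : Fin d) :
    Continuous (extendCoord hT x j) := by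
  unfold extendCoord
  have : Continuous fun s => x (Set.projIcc 0 T hT s) := x.continuous.comp continuous_projIcc
  fun_prop

lemma extendCoord_coe (hT : 0 ≤ T) (x : PathSpace d T) (j : Fin d) (t : Set.Icc (0 : ℝ) T) :
    extendCoord hT x j t = x t j := by simp [extendCoord]

variable {Ω : Type*} {mΩ : MeasurableSpace Ω}
  {𝓕 : Filtration (Set.Icc (0 : ℝ) T) mΩ} {Pr : Measure Ω} {W : Ω → Fin n → PathSpace d T}

/-- The Wiener integral `∑ i ∫₀ᵗ fᵢ dWⁱ`, written by integration by parts, is centred Gaussian with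
variance `∫₀ᵗ |f|²`. -/
theorem IsBrownianMotion.hasLaw_wienerIntegral [IsProbabilityMeasure Pr] (hT : 0 ≤ T)
    (hW : IsBrownianMotion 𝓕 Pr W) (j : Fin d) {f f' : Fin n → ℝ → ℝ}
    (hf : ∀ i s, HasDerivAt (f i) (f' i s) s) (hf' : ∀ i, Continuous (f' i))
    (t : Set.Icc (0 : ℝ) T) :
    HasLaw (fun ω => ∑ i, (f i t * extendCoord hT (W ω i) j t -
        ∫ s in (0 : ℝ)..t, extendCoord hT (W ω i) j s * f' i s))
      (gaussianReal 0 (Real.toNNReal (∫ s in (0 : ℝ)..t, ∑ i, f i s ^ 2))) Pr := by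
  have hfc : ∀ i, Continuous (f i) := fun i =>
    continuous_iff_continuousAt.2 fun s => (hf i s).continuousAt
  let τ : ℕ → ℕ → Set.Icc (0 : ℝ) T := fun N l => Set.projIcc 0 T hT ((l : ℝ) * t / N)
  have hτ : ∀ N, Monotone (τ N) := fun N l l' hl => Set.monotone_projIcc hT (by
    have := t.2.1
    gcongr)
  have hlaw := fun N => hW.hasLaw_sum_sum_mul_increment j (hτ N)
    (fun l i => f i ((l : ℝ) * t / N)) N
  refine hasLaw_gaussianReal_of_tendsto (fun N => ?_) hlaw ?_ ?_
  · exact Finset.sum_nonneg fun l _ => mul_nonneg (Finset.sum_nonneg fun i _ => sq_nonneg _)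
      (sub_nonneg.2 (Subtype.coe_le_coe.2 (hτ N l.le_succ)))
  · filter_upwards [hW.start] with ω hω
    have h := tendsto_finsetSum Finset.univ fun i _ => tendsto_stieltjesSum (hf i) (hf' i)
      (continuous_extendCoord hT (W ω i) j)
      (by simp [extendCoord, hω i ⟨0, le_rfl, hT⟩ rfl]) t.2.1
    refine h.congr fun N => ?_
    rw [Finset.sum_comm]
    rfl
  · have h := tendsto_riemannSum_mul (g := fun s => ∑ i, f i s ^ 2) (h := fun _ => 1)
      (by fun_prop) continuous_const t.2.1 0 zero_le_one
    simp only [mul_one, intervalIntegral.integral_const, smul_eq_mul, add_zero] at h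
    refine h.congr' ?_
    filter_upwards [eventually_gt_atTop 0] with N hN
    refine Finset.sum_congr rfl fun l hl => ?_
    have hNpos : (0 : ℝ) < N := by exact_mod_cast hN
    have hmem : ∀ l : ℕ, l ≤ N → (l : ℝ) * t / N ∈ Set.Icc 0 T := fun l hl => by
      have := t.2.1
      refine ⟨by positivity, le_trans ?_ t.2.2⟩
      rw [div_le_iff₀ hNpos, mul_comm]
      exact mul_le_mul_of_nonneg_left (by exact_mod_cast hl) t.2.1
    have hl' := Finset.mem_range.1 hl
    simp only [τ, Set.projIcc_of_mem hT (hmem _ hl'.le), Set.projIcc_of_mem hT (hmem _ hl')]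

end Wiener

/-! ### Linear integral equations. -/

section Deterministic

/-- Variation of constants: with `A s = ∫₀ˢ x`, the derivative of `exp (r (t - s)) * A s` is `exp (r
(t - s)) * w s`. -/
lemma eq_add_integral_of_linear {x w : ℝ → ℝ} (hx : Continuous x) (hw : Continuous w) {r t : ℝ}
    (ht : 0 ≤ t) (h : ∀ s ∈ Set.Icc 0 t, x s = r * (∫ q in (0 : ℝ)..s, x q) + w s) :
    x t = w t + r * ∫ s in (0 : ℝ)..t, Real.exp (r * (t - s)) * w s := by
  have hA : ∀ s, HasDerivAt (fun s => ∫ q in (0 : ℝ)..s, x q) (x s) s := fun s =>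
    intervalIntegral.integral_hasDerivAt_right (hx.intervalIntegrable _ _)
      hx.aestronglyMeasurable.stronglyMeasurableAtFilter hx.continuousAt
  have hE : ∀ s, HasDerivAt (fun s => Real.exp (r * (t - s)))
      (Real.exp (r * (t - s)) * (-r)) s := fun s => by
    have : HasDerivAt (fun s => r * (t - s)) (-r) s := by
      simpa using ((hasDerivAt_id s).const_sub t).const_mul r
    exact this.exp
  have hI := intervalIntegral.integral_eq_sub_of_hasDerivAt (a := 0) (b := t)
    (f := fun s => Real.exp (r * (t - s)) * ∫ q in (0 : ℝ)..s, x q)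
    (f' := fun s => Real.exp (r * (t - s)) * w s) (fun s hs => by
      rw [Set.uIcc_of_le ht] at hs
      convert! (hE s).mul (hA s) using 1
      rw [h s hs]
      ring) (Continuous.intervalIntegrable (by fun_prop) _ _)
  rw [hI, h t ⟨ht, le_rfl⟩]
  simp
  ring

/-- The convolution term in `g` is a primitive of `g`, so the hypotheses say `g = (a + b) ∫ g`, a
homogeneous equation. This will force the McKean–Vlasov mean to vanish. -/
lemma eq_zero_of_linear_of_primitive {M g : ℝ → ℝ} {a b T : ℝ} (hM : Continuous M)
    (hg : ∀ t, g t = M t + a * ∫ s in (0 : ℝ)..t, Real.exp (a * (t - s)) * M s)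
    (hMg : ∀ t ∈ Set.Icc 0 T, M t = b * ∫ s in (0 : ℝ)..t, g s) :
    ∀ t ∈ Set.Icc 0 T, g t = 0 := by
  have hK : ∀ t, HasDerivAt (fun t => ∫ s in (0 : ℝ)..t, Real.exp (-(a * s)) * M s)
      (Real.exp (-(a * t)) * M t) t := fun t => by
    have hc : Continuous fun s => Real.exp (-(a * s)) * M s := by fun_prop
    exact intervalIntegral.integral_hasDerivAt_right (hc.intervalIntegrable _ _)
      hc.aestronglyMeasurable.stronglyMeasurableAtFilter hc.continuousAt
  have hsplit : ∀ t, ∫ s in (0 : ℝ)..t, Real.exp (a * (t - s)) * M s =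
      Real.exp (a * t) * ∫ s in (0 : ℝ)..t, Real.exp (-(a * s)) * M s := fun t => by
    rw [← intervalIntegral.integral_const_mul]
    refine intervalIntegral.integral_congr fun s _ => ?_
    rw [← mul_assoc, ← Real.exp_add]
    ring_nf
  have hder : ∀ t, HasDerivAt (fun t => ∫ s in (0 : ℝ)..t, Real.exp (a * (t - s)) * M s) (g t) t := by
    intro t
    have hE : HasDerivAt (fun t => Real.exp (a * t)) (Real.exp (a * t) * a) t := by
      have : HasDerivAt (fun t => a * t) a t := by simpa using (hasDerivAt_id t).const_mul a
      exact this.exp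
    have := hE.mul (hK t)
    simp_rw [hg t, hsplit]
    convert! this using 1
    rw [← mul_assoc (Real.exp (a * t)) (Real.exp (-(a * t))), ← Real.exp_add]
    simp
    ring
  have hgc : Continuous g := by
    have : Continuous (fun t => ∫ s in (0 : ℝ)..t, Real.exp (a * (t - s)) * M s) :=
      continuous_iff_continuousAt.2 fun t => (hder t).continuousAt
    rw [show g = _ from funext hg]
    fun_prop
  have hprim : ∀ t, ∫ s in (0 : ℝ)..t, g s = ∫ s in (0 : ℝ)..t, Real.exp (a * (t - s)) * M s :=
    fun t => by
      rw [intervalIntegral.integral_eq_sub_of_hasDerivAt (fun s _ => hder s)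
        (hgc.intervalIntegrable _ _)]
      simp
  intro t ht
  have h := eq_add_integral_of_linear (r := a + b) (t := t) hgc continuous_const (w := fun _ => 0)
    ht.1 fun s hs => by
      rw [hg s, ← hprim, hMg s ⟨hs.1, hs.2.trans ht.2⟩]
      ring
  simpa using h

end Deterministic

/-! ### Integration over the time interval. -/

section TimeMeasure

variable {T : ℝ}

instance : IsFiniteMeasure (timeMeasure T) := by
  refine ⟨?_⟩
  rw [timeMeasure, (MeasurableEmbedding.subtype_coe measurableSet_Icc).comap_apply,
    Set.image_univ, Subtype.range_coe, Real.volume_Icc]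
  exact ENNReal.ofReal_lt_top

lemma map_val_timeMeasure : (timeMeasure T).map Subtype.val = volume.restrict (Set.Icc 0 T) :=
  map_comap_subtype_coe measurableSet_Icc _

lemma setIntegral_timeMeasure {E : Type*} [NormedAddCommGroup E] [NormedSpace ℝ E] (hT : 0 ≤ T)
    (φ : Set.Icc (0 : ℝ) T → E) {s t : Set.Icc (0 : ℝ) T} (hst : s ≤ t) :
    ∫ r in Set.Ioc s t, φ r ∂timeMeasure T = ∫ r in (s : ℝ)..t, φ (Set.projIcc 0 T hT r) := by
  have h := (MeasurableEmbedding.subtype_coe (measurableSet_Icc (a := (0 : ℝ)) (b := T))).setIntegral_map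
    (μ := timeMeasure T) (fun r => φ (Set.projIcc 0 T hT r)) (Set.Ioc (s : ℝ) t)
  have hpre : Subtype.val ⁻¹' Set.Ioc (s : ℝ) t = Set.Ioc s t := rfl
  simp only [Set.projIcc_val, hpre] at h
  rw [← h, map_val_timeMeasure, Measure.restrict_restrict measurableSet_Ioc,
    intervalIntegral.integral_of_le hst, Set.inter_eq_left.2]
  exact fun r hr => ⟨s.2.1.trans hr.1.le, hr.2.trans t.2.2⟩

lemma setIntegral_timeMeasure_apply {d : ℕ} (hT : 0 ≤ T)
    {φ : Set.Icc (0 : ℝ) T → EuclideanSpace ℝ (Fin d)} (hφ : Integrable φ (timeMeasure T))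
    (j : Fin d) {s t : Set.Icc (0 : ℝ) T} (hst : s ≤ t) :
    (∫ r in Set.Ioc s t, φ r ∂timeMeasure T) j =
      ∫ r in (s : ℝ)..t, φ (Set.projIcc 0 T hT r) j := by
  rw [eval_integral_piLp fun i => hφ.integrableOn.eval_piLp i]
  exact setIntegral_timeMeasure hT (fun r => φ r j) hst

lemma integrable_timeMeasure_of_continuous {E : Type*} [NormedAddCommGroup E]
    {φ : Set.Icc (0 : ℝ) T → E} (hφ : Continuous φ) : Integrable φ (timeMeasure T) :=
  hφ.integrable_of_hasCompactSupport (HasCompactSupport.of_compactSpace φ)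

end TimeMeasure

/-- The variance at time `t` of the one-dimensional Ornstein–Uhlenbeck process
`dX = r X dt + dW` started at `0`. -/
noncomputable def ouVar (r t : ℝ) : ℝ := ∫ s in (0 : ℝ)..t, Real.exp (r * (t - s)) ^ 2

lemma ouVar_nonneg (r : ℝ) {t : ℝ} (ht : 0 ≤ t) : 0 ≤ ouVar r t :=
  intervalIntegral.integral_nonneg ht fun _ _ => sq_nonneg _

lemma hasDerivAt_exp_mul_sub (r t s : ℝ) :
    HasDerivAt (fun s => Real.exp (r * (t - s))) (-r * Real.exp (r * (t - s))) s := by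
  have : HasDerivAt (fun s => r * (t - s)) (-r) s := by
    simpa using ((hasDerivAt_id s).const_sub t).const_mul r
  simpa [mul_comm] using this.exp

/-! ### Gaussian functionals of the particle system. -/

section Particle

variable {d n : ℕ} {T : ℝ} {a b : ℝ}

/-- A solution of the deterministic linear mean field system, tested against a vector `c`. -/
lemma sum_mul_eq_of_linear_system (hn : 2 ≤ n) {x w : Fin n → ℝ → ℝ} (hx : ∀ i, Continuous (x i))
    (hw : ∀ i, Continuous (w i)) {t : ℝ} (ht : 0 ≤ t)
    (h : ∀ i, ∀ s ∈ Set.Icc 0 t, x i s = (∫ q in (0 : ℝ)..s,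
      (a * x i q + 1 / ((n : ℝ) - 1) * ∑ l ∈ Finset.univ.erase i, b * x l q)) + w i s)
    (c : Fin n → ℝ) (m : ℝ) (hm : m * n = ∑ i, c i) :
    ∑ i, c i * x i t = ∑ i, ((m * Real.exp ((a + b) * (t - t)) +
        (c i - m) * Real.exp ((a - b / (n - 1)) * (t - t))) * w i t -
      ∫ s in (0 : ℝ)..t, w i s * (m * (-(a + b) * Real.exp ((a + b) * (t - s))) +
        (c i - m) * (-(a - b / (n - 1)) * Real.exp ((a - b / (n - 1)) * (t - s))))) := by
  have hn1 : (n : ℝ) - 1 ≠ 0 := by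
    have : (2 : ℝ) ≤ n := by exact_mod_cast hn
    linarith
  set A : Fin n → ℝ → ℝ := fun i s => ∫ q in (0 : ℝ)..s, x i q with hA
  have hxi : ∀ i s, IntervalIntegrable (x i) volume 0 s := fun i s =>
    (hx i).intervalIntegrable _ _
  have hxA : ∀ i, ∀ s ∈ Set.Icc 0 t,
      -- Including the missing index `i` in the interaction sum shifts the own rate to `a -
      -- b/(n-1)`.
      x i s = (a - b / (n - 1)) * A i s + b / (n - 1) * ∑ l, A l s + w i s := fun i s hs => by
    rw [h i s hs, hA]
    have h1 : ∀ q, a * x i q + 1 / ((n : ℝ) - 1) * ∑ l ∈ Finset.univ.erase i, b * x l q =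
        (a - b / (n - 1)) * x i q + b / (n - 1) * ∑ l, x l q := fun q => by
      rw [← Finset.mul_sum, ← Finset.add_sum_erase Finset.univ (fun l => x l q) (Finset.mem_univ i)]
      ring
    simp only [h1]
    rw [intervalIntegral.integral_add ((hxi i s).const_mul _)
      (Continuous.intervalIntegrable (by fun_prop) _ _), intervalIntegral.integral_const_mul,
      intervalIntegral.integral_const_mul, intervalIntegral.integral_finsetSum fun l _ => hxi l s]
  -- Mean mode: summing over all particles closes the system, with rate `a + b`.
  have hS := eq_add_integral_of_linear (x := fun s => ∑ i, x i s) (w := fun s => ∑ i, w i s)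
    (r := a + b) (by fun_prop) (by fun_prop) ht fun s hs => by
      rw [intervalIntegral.integral_finsetSum fun l _ => hxi l s, Finset.sum_congr rfl
        fun i _ => hxA i s hs]
      simp only [Finset.sum_add_distrib, ← Finset.mul_sum, Finset.sum_const, Finset.card_univ,
        Fintype.card_fin, nsmul_eq_mul]
      field_simp
      ring
  -- Since `m` is the average of `c`, the weights `c i - m` sum to zero and annihilate the common
  -- interaction term; only the rate `a - b/(n-1)` remains.
  have hZ := eq_add_integral_of_linear (x := fun s => ∑ i, (c i - m) * x i s)
    (w := fun s => ∑ i, (c i - m) * w i s)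
    (r := a - b / (n - 1)) (by fun_prop) (by fun_prop) ht fun s hs => by
      rw [intervalIntegral.integral_finsetSum fun l _ => (hxi l s).const_mul _, Finset.sum_congr rfl
        fun i _ => congrArg _ (hxA i s hs)]
      simp only [mul_add, Finset.sum_add_distrib, ← Finset.sum_mul, Finset.sum_sub_distrib, ← hm,
        Finset.sum_const, Finset.card_univ, Fintype.card_fin, nsmul_eq_mul,
        intervalIntegral.integral_const_mul]
      rw [show m * (n : ℝ) - n * m = 0 by ring, zero_mul, add_zero]
      congr 1
      rw [Finset.mul_sum]
      exact Finset.sum_congr rfl fun i _ => mul_left_comm _ _ _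
  have hlhs : ∑ i, c i * x i t = m * ∑ i, x i t + ∑ i, (c i - m) * x i t := by
    rw [Finset.mul_sum, ← Finset.sum_add_distrib]
    exact Finset.sum_congr rfl fun i _ => by ring
  rw [hlhs]
  beta_reduce at hS hZ
  rw [hS, hZ]
  simp only [Finset.mul_sum]
  rw [intervalIntegral.integral_finsetSum fun i _ => Continuous.intervalIntegrable (by fun_prop) _ _,
    intervalIntegral.integral_finsetSum fun i _ => Continuous.intervalIntegrable (by fun_prop) _ _]
  simp only [Finset.mul_sum, ← Finset.sum_add_distrib]
  refine Finset.sum_congr rfl fun i _ => ?_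
  have hsplit : ∫ s in (0 : ℝ)..t, w i s * (m * (-(a + b) * Real.exp ((a + b) * (t - s))) +
        (c i - m) * (-(a - b / (n - 1)) * Real.exp ((a - b / (n - 1)) * (t - s)))) =
      -(m * (a + b)) * (∫ s in (0 : ℝ)..t, Real.exp ((a + b) * (t - s)) * w i s) +
      -(a - b / (n - 1)) *
        ∫ s in (0 : ℝ)..t, Real.exp ((a - b / (n - 1)) * (t - s)) * ((c i - m) * w i s) := by
    rw [← intervalIntegral.integral_const_mul, ← intervalIntegral.integral_const_mul,
      ← intervalIntegral.integral_add (Continuous.intervalIntegrable (by fun_prop) _ _)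
        (Continuous.intervalIntegrable (by fun_prop) _ _)]
    exact intervalIntegral.integral_congr fun s _ => by ring
  rw [hsplit]
  -- The factors `exp (r * (t - t))` equal `1`; the statement keeps them so that it matches the
  -- boundary term of the Wiener integral.
  simp only [sub_self, mul_zero, Real.exp_zero]
  ring

lemma measurable_eval_coord (t : Set.Icc (0 : ℝ) T) (j : Fin d) :
    Measurable fun x : PathSpace d T => x t j := by
  have : Continuous fun x : PathSpace d T => x t := continuous_eval_const t
  exact (by fun_prop : Continuous fun x : PathSpace d T => x t j).measurable

/-- Linear functionals of the particle system at time `t` are centred Gaussian. -/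
theorem IsParticleLaw.hasLaw_sum_mul (hn : 2 ≤ n) (hT : 0 < T)
    {P : Measure (Fin n → PathSpace d T)}
    (hP : IsParticleLaw.{u} (fun t x => a • x t) (fun t _ y => b • y t) P)
    (hP0 : timeMarginal ⟨0, le_rfl, hT.le⟩ P = Measure.dirac 0)
    (t : Set.Icc (0 : ℝ) T) (j : Fin d) (c : Fin n → ℝ) :
    HasLaw (fun x : Fin n → PathSpace d T => ∑ i, c i * x i t j)
      (gaussianReal 0 (Real.toNNReal ((∑ i, c i) ^ 2 / n * ouVar (a + b) t +
        (∑ i, c i ^ 2 - (∑ i, c i) ^ 2 / n) * ouVar (a - b / (n - 1)) t))) P := by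
  obtain ⟨Ω, mΩ, Pr, 𝓕, X, W, hPr, ⟨hW, hXa, heq⟩, -, hlaw⟩ := hP
  have hmeas : Measurable fun x : Fin n → PathSpace d T => ∑ i, c i * x i t j :=
    Finset.measurable_fun_sum _ fun i _ =>
      ((measurable_eval_coord t j).comp (measurable_pi_apply i)).const_mul _
  refine HasLaw.comp_of_hasLaw_comp (f := fun x : Fin n → PathSpace d T => ∑ i, c i * x i t j)
    hmeas.aemeasurable hlaw HasLaw.id ?_
  have hn0 : (n : ℝ) ≠ 0 := by
    have : n ≠ 0 := by omega
    exact_mod_cast this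
  set m : ℝ := (∑ i, c i) / n with hm
  have hmn : m * n = ∑ i, c i := div_mul_cancel₀ _ hn0
  have hX0 : ∀ᵐ ω ∂Pr, ∀ i, X ω i ⟨0, le_rfl, hT.le⟩ = 0 := by
    have hev : Measurable fun (x : Fin n → PathSpace d T) (i : Fin n) => x i ⟨0, le_rfl, hT.le⟩ :=
      measurable_pi_iff.2 fun i => (continuous_eval_const
        (⟨0, le_rfl, hT.le⟩ : Set.Icc (0 : ℝ) T)).measurable.comp (measurable_pi_apply i)
    have h0 : HasLaw (fun (x : Fin n → PathSpace d T) (i : Fin n) => x i ⟨0, le_rfl, hT.le⟩)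
        (Measure.dirac 0) P := ⟨hev.aemeasurable, hP0⟩
    filter_upwards [(h0.fun_comp hlaw).ae_eq_of_dirac] with ω hω i
    exact congrFun hω i
  have hwi := hW.hasLaw_wienerIntegral hT.le j
    (f := fun i s => m * Real.exp ((a + b) * (t - s)) +
        (c i - m) * Real.exp ((a - b / (n - 1)) * (t - s)))
    (f' := fun i s => m * (-(a + b) * Real.exp ((a + b) * (t - s))) +
        (c i - m) * (-(a - b / (n - 1)) * Real.exp ((a - b / (n - 1)) * (t - s))))
    (fun i s => ((hasDerivAt_exp_mul_sub _ _ _).const_mul _).add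
      ((hasDerivAt_exp_mul_sub _ _ _).const_mul _)) (fun i => by fun_prop) t
  -- The two modes are orthogonal because `∑ (c i - m) = 0`, so the variance splits with weights `n
  -- m² = (∑ c)²/n` and `∑ c² - (∑ c)²/n`.
  have hvar : ∫ s in (0 : ℝ)..t, ∑ i, (m * Real.exp ((a + b) * (t - s)) +
        (c i - m) * Real.exp ((a - b / (n - 1)) * (t - s))) ^ 2 =
      (∑ i, c i) ^ 2 / n * ouVar (a + b) t +
        (∑ i, c i ^ 2 - (∑ i, c i) ^ 2 / n) * ouVar (a - b / (n - 1)) t := by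
    rw [ouVar, ouVar, ← intervalIntegral.integral_const_mul, ← intervalIntegral.integral_const_mul,
      ← intervalIntegral.integral_add (Continuous.intervalIntegrable (by fun_prop) _ _)
        (Continuous.intervalIntegrable (by fun_prop) _ _)]
    refine intervalIntegral.integral_congr fun s _ => ?_
    generalize Real.exp ((a + b) * (t - s)) = e₁
    generalize Real.exp ((a - b / (n - 1)) * (t - s)) = e₂
    have h1 : ∀ i, (m * e₁ + (c i - m) * e₂) ^ 2 =
        m ^ 2 * (e₁ - e₂) ^ 2 + 2 * m * (e₁ - e₂) * e₂ * c i + e₂ ^ 2 * c i ^ 2 := fun i => by ring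
    simp only [h1, Finset.sum_add_distrib, ← Finset.mul_sum, Finset.sum_const, Finset.card_univ,
      Fintype.card_fin, nsmul_eq_mul, ← hmn]
    field_simp
    ring
  rw [hvar] at hwi
  refine hwi.congr ?_
  filter_upwards [heq, hX0, hW.start] with ω hω hω0 hωW
  have key := sum_mul_eq_of_linear_system (a := a) (b := b) hn
    (x := fun i => extendCoord hT.le (X ω i) j) (w := fun i => extendCoord hT.le (W ω i) j)
    (fun i => continuous_extendCoord _ _ _) (fun i => continuous_extendCoord _ _ _) t.2.1
    (fun i s hs => by
      have hs' : s ∈ Set.Icc 0 T := ⟨hs.1, hs.2.trans t.2.2⟩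
      have h := congrArg (fun y : EuclideanSpace ℝ (Fin d) => y j)
        (hω i ⟨0, le_rfl, hT.le⟩ ⟨s, hs'⟩ hs'.1)
      have hc : ∀ i, Continuous (X ω i) := fun i => (X ω i).continuous
      simp only [PiLp.add_apply, hω0, hωW i ⟨0, le_rfl, hT.le⟩ rfl, sub_zero] at h
      have hI := setIntegral_timeMeasure_apply hT.le (φ := fun r => a • X ω i r +
          (1 / ((n : ℝ) - 1)) • ∑ l ∈ Finset.univ.erase i, b • X ω l r)
        (integrable_timeMeasure_of_continuous (by fun_prop)) j
        (s := ⟨0, le_rfl, hT.le⟩) (t := ⟨s, hs'⟩) hs'.1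
      have h' := h.trans (congrArg (· + W ω i ⟨s, hs'⟩ j) hI)
      simpa [extendCoord, Set.projIcc_of_mem hT.le hs'] using h') c m hmn
  simp only [extendCoord_coe] at key ⊢
  exact key

end Particle

/-! ### Gaussian marginals of the McKean–Vlasov law. -/

section McKeanVlasov

variable {d : ℕ} {T : ℝ} {a b : ℝ}

lemma stronglyMeasurable_integral_eval (μ : Measure (PathSpace d T)) [SFinite μ] :
    StronglyMeasurable fun r : Set.Icc (0 : ℝ) T => ∫ y : PathSpace d T, b • y r ∂μ := by
  have h : Continuous fun p : Set.Icc (0 : ℝ) T × PathSpace d T => b • p.2 p.1 := by fun_prop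
  exact h.stronglyMeasurable.integral_prod_right'

lemma integrable_integral_eval {μ : Measure (PathSpace d T)} [SFinite μ]
    (h : ∫⁻ r, ∫⁻ y : PathSpace d T, ‖b • y r‖ₑ ∂μ ∂timeMeasure T < ∞) :
    Integrable (fun r : Set.Icc (0 : ℝ) T => ∫ y : PathSpace d T, b • y r ∂μ) (timeMeasure T) :=
  ⟨(stronglyMeasurable_integral_eval μ).aestronglyMeasurable,
    (lintegral_mono fun _ => enorm_integral_le_lintegral_enorm _).trans_lt h⟩

lemma integrable_indicator_projIcc (hT : 0 ≤ T)
    {φ : Set.Icc (0 : ℝ) T → ℝ} (hφ : Integrable φ (timeMeasure T)) :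
    Integrable ((Set.Icc 0 T).indicator fun r => φ (Set.projIcc 0 T hT r)) := by
  rw [integrable_indicator_iff measurableSet_Icc, IntegrableOn, ← map_val_timeMeasure,
    (MeasurableEmbedding.subtype_coe measurableSet_Icc).integrable_map_iff]
  simpa [Function.comp_def] using hφ

/-- The one-dimensional time marginals of the McKean–Vlasov law are centred Gaussian. -/
theorem IsMcKeanVlasovLaw.hasLaw_eval (hT : 0 < T) {μ : Measure (PathSpace d T)}
    (hμ : IsMcKeanVlasovLaw.{v} (fun t x => a • x t) (fun t _ y => b • y t) μ)
    (hμ0 : μ.map (fun x => x ⟨0, le_rfl, hT.le⟩) = Measure.dirac 0)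
    (t : Set.Icc (0 : ℝ) T) (j : Fin d) :
    HasLaw (fun x : PathSpace d T => x t j) (gaussianReal 0 (ouVar a t).toNNReal) μ := by
  obtain ⟨Ω, mΩ, Pr, 𝓕, X, W, hPr, ⟨hW, hXa, heq⟩, hint, hlaw⟩ := hμ
  have hμp : IsProbabilityMeasure μ := hlaw.isProbabilityMeasure_iff.1 hPr
  have hX0 : ∀ᵐ ω ∂Pr, X ω 0 ⟨0, le_rfl, hT.le⟩ = 0 := by
    have h0 : HasLaw (fun x : PathSpace d T => x ⟨0, le_rfl, hT.le⟩) (Measure.dirac 0) μ :=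
      ⟨(continuous_eval_const _).measurable.aemeasurable, hμ0⟩
    exact (h0.fun_comp hlaw).ae_eq_of_dirac
  set B : Set.Icc (0 : ℝ) T → EuclideanSpace ℝ (Fin d) := fun r => ∫ y, b • y r ∂μ with hB
  have hBint : Integrable B (timeMeasure T) := by
    -- The mean-field part of the integrability condition does not depend on `ω`, so one good `ω` is
    -- enough.
    obtain ⟨ω, hω⟩ := hint.exists
    exact integrable_integral_eval ((lintegral_mono fun r => le_add_self).trans_lt hω)
  let M : Fin d → ℝ → ℝ := fun i s => ∫ r in (0 : ℝ)..s,
    (Set.Icc 0 T).indicator (fun r => B (Set.projIcc 0 T hT.le r) i) r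
  have hM : ∀ i, Continuous (M i) := fun i => intervalIntegral.continuous_primitive
    (fun _ _ => (integrable_indicator_projIcc hT.le (hBint.eval_piLp i)).intervalIntegrable) 0
  have hMeq : ∀ i, ∀ s ∈ Set.Icc 0 T, M i s = ∫ r in (0 : ℝ)..s, B (Set.projIcc 0 T hT.le r) i :=
    fun i s hs => intervalIntegral.integral_congr fun r hr => by
      rw [Set.uIcc_of_le hs.1] at hr
      exact Set.indicator_of_mem (show r ∈ Set.Icc 0 T from ⟨hr.1, hr.2.trans hs.2⟩) _
  -- Treating the mean-field drift as a known deterministic forcing, `g` is the mean of the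
  -- resulting Gaussian marginal.
  let g : Fin d → ℝ → ℝ := fun i t =>
    M i t + a * ∫ s in (0 : ℝ)..t, Real.exp (a * (t - s)) * M i s
  have hgauss : ∀ (t : Set.Icc (0 : ℝ) T) (i : Fin d),
      HasLaw (fun x : PathSpace d T => x t i) (gaussianReal (g i t) (ouVar a t).toNNReal) μ := by
    intro t i
    refine HasLaw.comp_of_hasLaw_comp (f := fun x : PathSpace d T => x t i)
      (measurable_eval_coord t i).aemeasurable hlaw HasLaw.id ?_
    have hwi := gaussianReal_add_const (hW.hasLaw_wienerIntegral hT.le i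
      (f := fun _ s => Real.exp (a * (t - s))) (f' := fun _ s => -a * Real.exp (a * (t - s)))
      (fun _ s => hasDerivAt_exp_mul_sub _ _ _) (fun _ => by fun_prop) t) (g i t)
    simp only [Fin.sum_univ_one, zero_add] at hwi
    refine hwi.congr ?_
    filter_upwards [heq, hX0, hW.start] with ω hω hω0 hωW
    have hwc := continuous_extendCoord hT.le (W ω 0) i
    have hMc := hM i
    have key := eq_add_integral_of_linear (r := a) (x := extendCoord hT.le (X ω 0) i)
      (w := fun s => extendCoord hT.le (W ω 0) i s + M i s)
      (continuous_extendCoord _ _ _) (hwc.add (hM i)) t.2.1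
      (fun s hs => by
        have hs' : s ∈ Set.Icc 0 T := ⟨hs.1, hs.2.trans t.2.2⟩
        have h := congrArg (fun y : EuclideanSpace ℝ (Fin d) => y i)
          (hω 0 ⟨0, le_rfl, hT.le⟩ ⟨s, hs'⟩ hs'.1)
        have hc : Continuous (X ω 0) := (X ω 0).continuous
        simp only [PiLp.add_apply, hω0, hωW 0 ⟨0, le_rfl, hT.le⟩ rfl, sub_zero] at h
        have hcint : Integrable (fun r => a • X ω 0 r) (timeMeasure T) :=
          integrable_timeMeasure_of_continuous (by fun_prop)
        rw [integral_add hcint.integrableOn hBint.integrableOn, PiLp.add_apply] at h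
        have h1 := setIntegral_timeMeasure_apply hT.le hcint i
          (s := ⟨0, le_rfl, hT.le⟩) (t := ⟨s, hs'⟩) hs'.1
        have h2 := setIntegral_timeMeasure_apply hT.le hBint i
          (s := ⟨0, le_rfl, hT.le⟩) (t := ⟨s, hs'⟩) hs'.1
        rw [← hMeq i s hs'] at h2
        have h' := h.trans (congrArg (· + W ω 0 ⟨s, hs'⟩ i) (congrArg₂ (· + ·) h1 h2))
        simp only [PiLp.smul_apply, smul_eq_mul, intervalIntegral.integral_const_mul] at h'
        simp only [extendCoord, Set.projIcc_of_mem hT.le hs']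
        rw [h']
        ring)
    rw [← extendCoord_coe hT.le, key]
    simp only [g, mul_add, sub_self, mul_zero, Real.exp_zero, one_mul]
    rw [intervalIntegral.integral_add (Continuous.intervalIntegrable (by fun_prop) _ _)
      (Continuous.intervalIntegrable (by fun_prop) _ _)]
    have : ∫ s in (0 : ℝ)..t, extendCoord hT.le (W ω 0) i s * (-a * Real.exp (a * (t - s))) =
        -a * ∫ s in (0 : ℝ)..t, Real.exp (a * (t - s)) * extendCoord hT.le (W ω 0) i s := by
      rw [← intervalIntegral.integral_const_mul]
      exact intervalIntegral.integral_congr fun s _ => by ring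
    rw [this]
    ring
  -- Self-consistency: the marginals are now known to be Gaussian, hence integrable, so the drift
  -- can be computed from their means `g`.
  have hmean : ∀ (r : Set.Icc (0 : ℝ) T) (i : Fin d), B r i = b * g i r := by
    intro r i
    have hi : ∀ i, Integrable (fun x : PathSpace d T => x r i) μ := fun i => by
      have h1 : Integrable id (μ.map fun x : PathSpace d T => x r i) := by
        rw [(hgauss r i).map_eq]
        exact (memLp_id_gaussianReal 1).integrable (by simp)
      exact h1.comp_aemeasurable (hgauss r i).aemeasurable
    rw [hB]
    beta_reduce
    rw [eval_integral_piLp fun i => (hi i).const_mul b]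
    simp only [PiLp.smul_apply, smul_eq_mul]
    rw [integral_const_mul, (hgauss r i).integral_eq, integral_id_gaussianReal]
  have hg0 : g j t = 0 := by
    refine eq_zero_of_linear_of_primitive (a := a) (b := b) (T := T) (hM j) (fun _ => rfl)
      (fun s hs => ?_) t t.2
    rw [hMeq j s hs, ← intervalIntegral.integral_const_mul]
    refine intervalIntegral.integral_congr fun r hr => ?_
    rw [Set.uIcc_of_le hs.1] at hr
    have hr' : r ∈ Set.Icc 0 T := ⟨hr.1, hr.2.trans hs.2⟩
    beta_reduce
    rw [hmean, Set.projIcc_of_mem hT.le hr']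
  have := hgauss t j
  rwa [hg0] at this

end McKeanVlasov

/-! ### Lower bounds for transport cost and entropy from a variance gap. -/

section Distances

/-- Factor `p - q = (√p - √q)(√p + √q)`; the constant comes from `(√p + √q)² ≤ 2(p + q) ≤ 6q`. -/
lemma sq_sub_sq_bound {p q : ℝ} (hp : 0 ≤ p) (hq : 0 < q) (h : p ≤ 2 * q) :
    (p - q) ^ 2 / (6 * q) ≤ (√p - √q) ^ 2 := by
  have h1 := Real.sq_sqrt hp
  have h2 := Real.sq_sqrt hq.le
  rw [div_le_iff₀ (by positivity)]
  have h3 : (p - q) ^ 2 = (√p - √q) ^ 2 * (√p + √q) ^ 2 := by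
    nth_rewrite 1 [← h1, ← h2]
    ring
  rw [h3]
  refine mul_le_mul_of_nonneg_left ?_ (sq_nonneg _)
  nlinarith [sq_nonneg (√p - √q)]

lemma integral_sq_of_hasLaw {Ω : Type*} {mΩ : MeasurableSpace Ω} {Pr : Measure Ω} {U : Ω → ℝ}
    {p : ℝ} (hp : 0 ≤ p) (h : HasLaw U (gaussianReal 0 p.toNNReal) Pr) :
    Integrable (fun ω => U ω ^ 2) Pr ∧ ∫ ω, U ω ^ 2 ∂Pr = p := by
  have hG : Integrable (fun x : ℝ => x ^ 2) (gaussianReal 0 p.toNNReal) :=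
    (memLp_id_gaussianReal 2).integrable_sq
  constructor
  · rw [← h.map_eq] at hG
    exact hG.comp_aemeasurable h.aemeasurable
  · have h1 := h.integral_comp (f := fun x : ℝ => x ^ 2) (by fun_prop)
    rw [Function.comp_def] at h1
    rw [h1]
    have h2 := variance_id_gaussianReal (μ := 0) (v := p.toNNReal)
    rw [variance_of_integral_eq_zero (by fun_prop) (by simp [integral_id_gaussianReal])] at h2
    simpa [hp] using h2

/-- The transport cost dominates the squared difference of standard deviations of a `1`-Lipschitz
functional. -/
lemma ofReal_le_wassersteinSq {α : Type*} [MeasurableSpace α] {ρ : α → α → ℝ≥0∞}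
    {ν ν' : Measure α} {U : α → ℝ} (hU : ∀ x y, ENNReal.ofReal |U x - U y| ≤ ρ x y)
    {p q : ℝ} (hp : 0 ≤ p) (hq : 0 < q)
    (hν : HasLaw U (gaussianReal 0 p.toNNReal) ν) (hν' : HasLaw U (gaussianReal 0 q.toNNReal) ν')
    (hpq : p ≤ 2 * q) :
    ENNReal.ofReal ((p - q) ^ 2 / (6 * q)) ≤ wassersteinSq ρ ν ν' := by
  refine le_iInf₂ fun π hπ => ?_
  have h1 : HasLaw (fun z : α × α => U z.1) (gaussianReal 0 p.toNNReal) π :=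
    hν.fun_comp ⟨measurable_fst.aemeasurable, hπ.1⟩
  have h2 : HasLaw (fun z : α × α => U z.2) (gaussianReal 0 q.toNNReal) π :=
    hν'.fun_comp ⟨measurable_snd.aemeasurable, hπ.2⟩
  obtain ⟨i1, e1⟩ := integral_sq_of_hasLaw hp h1
  obtain ⟨i2, e2⟩ := integral_sq_of_hasLaw hq.le h2
  have hq' : 0 < √q := Real.sqrt_pos.2 hq
  have hp2 := Real.sq_sqrt hp
  have hq2 := Real.sq_sqrt hq.le
  have i3 : Integrable (fun z : α × α => (U z.1 - U z.2) ^ 2) π := by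
    refine ((i1.add i2).const_mul 2).mono'
      ((h1.aemeasurable.sub h2.aemeasurable).pow_const 2).aestronglyMeasurable
      (ae_of_all _ fun z => ?_)
    simp only [Real.norm_eq_abs, abs_sq, Pi.add_apply]
    nlinarith [sq_nonneg (U z.1 + U z.2)]
  have hlow : (√p - √q) ^ 2 ≤ ∫ z, (U z.1 - U z.2) ^ 2 ∂π := by
    -- The weights used below divide by `√p`, so the degenerate law is treated apart.
    rcases hp.eq_or_lt with rfl | hp0
    · have : U ∘ Prod.fst =ᵐ[π] fun _ => 0 := by
        have := h1
        rw [Real.toNNReal_zero, gaussianReal_zero_var] at this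
        exact this.ae_eq_of_dirac
      have : ∫ z, (U z.1 - U z.2) ^ 2 ∂π = ∫ z, U z.2 ^ 2 ∂π := integral_congr_ae (by
        filter_upwards [this] with z hz
        simp only [Function.comp_apply] at hz
        rw [hz]; ring)
      rw [this, e2]
      simp [hq2]
    have hp' : 0 < √p := Real.sqrt_pos.2 hp0
    -- Weighted AM–GM for the cross term, with weights chosen so that the left side integrates to
    -- exactly `(√p - √q)²`; this replaces Cauchy–Schwarz.
    have hle : ∫ z : α × α, ((1 - √q / √p) * U z.1 ^ 2 + (1 - √p / √q) * U z.2 ^ 2) ∂π ≤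
        ∫ z, (U z.1 - U z.2) ^ 2 ∂π := by
      refine integral_mono ((i1.const_mul _).add (i2.const_mul _)) i3 fun z => ?_
      beta_reduce
      have : (U z.1 - U z.2) ^ 2 - ((1 - √q / √p) * U z.1 ^ 2 + (1 - √p / √q) * U z.2 ^ 2) =
          (√q * U z.1 - √p * U z.2) ^ 2 / (√p * √q) := by
        field_simp
        ring
      have h0 : 0 ≤ (√q * U z.1 - √p * U z.2) ^ 2 / (√p * √q) := by positivity
      linarith
    refine le_trans (le_of_eq ?_) hle
    rw [integral_add (i1.const_mul _) (i2.const_mul _), integral_const_mul, integral_const_mul,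
      e1, e2]
    generalize √p = P at *
    generalize √q = Q at *
    subst hp2 hq2
    field_simp
    ring
  calc ENNReal.ofReal ((p - q) ^ 2 / (6 * q))
      ≤ ENNReal.ofReal (∫ z, (U z.1 - U z.2) ^ 2 ∂π) :=
        ENNReal.ofReal_le_ofReal ((sq_sub_sq_bound hp hq hpq).trans hlow)
    _ = ∫⁻ z, ENNReal.ofReal ((U z.1 - U z.2) ^ 2) ∂π :=
        ofReal_integral_eq_lintegral_ofReal i3 (ae_of_all _ fun z => sq_nonneg _)
    _ ≤ ∫⁻ z, ρ z.1 z.2 ^ 2 ∂π := lintegral_mono fun z => by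
        rw [← sq_abs, ENNReal.ofReal_pow (abs_nonneg _)]
        exact pow_le_pow_left' (hU z.1 z.2) 2

/-- The lower bound in the Donsker–Varadhan variational formula. -/
lemma ofReal_integral_sub_log_le_klDiv {α : Type*} [MeasurableSpace α] {μ ν : Measure α}
    [IsProbabilityMeasure μ] [IsProbabilityMeasure ν] {f : α → ℝ} (hf : Integrable f μ)
    (hfe : Integrable (fun x => Real.exp (f x)) ν) :
    ENNReal.ofReal (∫ x, f x ∂μ - Real.log (∫ x, Real.exp (f x) ∂ν)) ≤
      InformationTheory.klDiv μ ν := by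
  by_cases h : μ ≪ ν ∧ Integrable (llr μ ν) μ
  · obtain ⟨hac, hi⟩ := h
    rw [InformationTheory.klDiv_of_ac_of_integrable hac hi]
    refine ENNReal.ofReal_le_ofReal ?_
    have : IsProbabilityMeasure (ν.tilted f) := isProbabilityMeasure_tilted hfe
    -- Nonnegativity of the entropy of `μ` relative to the tilted measure `ν.tilted f` is the
    -- claimed inequality.
    have h0 := InformationTheory.integral_llr_add_sub_measure_univ_nonneg
      (hac.trans (absolutelyContinuous_tilted hfe)) (integrable_llr_tilted_right hac hf hi hfe)
    rw [integral_llr_tilted_right hac hf hfe hi] at h0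
    simp only [probReal_univ] at h0 ⊢
    linarith
  · rw [InformationTheory.klDiv_eq_top_iff.2 fun hac hi => h ⟨hac, hi⟩]
    exact le_top

lemma integral_exp_mul_sq_gaussianReal {q θ : ℝ} (hq : 0 < q) (hθ : 2 * θ * q < 1) :
    Integrable (fun x => Real.exp (θ * x ^ 2)) (gaussianReal 0 q.toNNReal) ∧
    ∫ x, Real.exp (θ * x ^ 2) ∂gaussianReal 0 q.toNNReal = (√(1 - 2 * θ * q))⁻¹ := by
  have hq0 : q.toNNReal ≠ 0 := by simpa using hq
  have hc : 0 < 1 / (2 * q) - θ := by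
    rw [sub_pos, lt_div_iff₀ (by positivity)]
    linarith
  have hpt : ∀ x, gaussianPDFReal 0 q.toNNReal x * Real.exp (θ * x ^ 2) =
      (√(2 * Real.pi * q))⁻¹ * Real.exp (-(1 / (2 * q) - θ) * x ^ 2) := fun x => by
    rw [gaussianPDFReal, Real.coe_toNNReal _ hq.le, mul_assoc, ← Real.exp_add]
    congr 2
    field_simp
    ring
  constructor
  · rw [gaussianReal_of_var_ne_zero _ hq0, integrable_withDensity_iff_integrable_smul₀'
      (by fun_prop) (ae_of_all _ fun x => gaussianPDF_lt_top)]
    simp only [toReal_gaussianPDF, smul_eq_mul, hpt]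
    exact (integrable_exp_neg_mul_sq hc).const_mul _
  · rw [integral_gaussianReal_eq_integral_smul hq0]
    simp only [smul_eq_mul, hpt]
    rw [integral_const_mul, integral_gaussian, ← Real.sqrt_inv, ← Real.sqrt_inv,
      ← Real.sqrt_mul (by positivity)]
    congr 1
    have : 1 - 2 * θ * q ≠ 0 := by linarith
    have h2 : (1 / (2 * q) - θ) = (1 - 2 * θ * q) / (2 * q) := by field_simp
    rw [h2]
    field_simp

/-- Equivalent to `1 ≤ (1 - x) exp (x + x²)`. The linear bound on `exp` gives `1 - x³`, enough only
for `x ≤ 0`; for `x ≥ 0` the quadratic bound is needed. -/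
lemma neg_sub_sq_le_log_one_sub {x : ℝ} (hx : |x| ≤ 1 / 2) : -x - x ^ 2 ≤ Real.log (1 - x) := by
  have h := abs_le.1 hx
  rw [Real.le_log_iff_exp_le (by linarith)]
  rw [show -x - x ^ 2 = -(x + x ^ 2) by ring, Real.exp_neg, inv_le_comm₀ (Real.exp_pos _) (by linarith)]
  rw [inv_le_iff_one_le_mul₀ (by linarith)]
  rcases le_total x 0 with hx0 | hx0
  · have h1 := Real.add_one_le_exp (x + x ^ 2)
    have h2 : 1 ≤ (x + x ^ 2 + 1) * (1 - x) := by nlinarith [mul_nonneg (neg_nonneg.2 hx0) (sq_nonneg x)]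
    exact h2.trans (mul_le_mul_of_nonneg_right h1 (by linarith))
  · have h1 := Real.quadratic_le_exp_of_nonneg (x := x + x ^ 2) (by positivity)
    have h2 : 1 ≤ (1 + (x + x ^ 2) + (x + x ^ 2) ^ 2 / 2) * (1 - x) := by
      have h3 : (1 + (x + x ^ 2) + (x + x ^ 2) ^ 2 / 2) * (1 - x) =
          1 + x ^ 2 / 2 * (1 - x - x ^ 2 - x ^ 3) := by ring
      have h4 : 0 ≤ 1 - x - x ^ 2 - x ^ 3 := by nlinarith [mul_nonneg hx0 hx0, mul_nonneg hx0 (mul_nonneg hx0 hx0)]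
      rw [h3]
      nlinarith [mul_nonneg (sq_nonneg x) h4]
    exact h2.trans (mul_le_mul_of_nonneg_right h1 (by linarith))

/-- Data processing along `U` reduces to two centred Gaussians on `ℝ`, where the variational formula
is tested on `θ x²`. -/
lemma ofReal_le_klDiv {α : Type*} [MeasurableSpace α]
    {ν ν' : Measure α} [IsProbabilityMeasure ν] [IsProbabilityMeasure ν'] {U : α → ℝ}
    {p q : ℝ} (hp : 0 ≤ p) (hq : 0 < q)
    (hν : HasLaw U (gaussianReal 0 p.toNNReal) ν) (hν' : HasLaw U (gaussianReal 0 q.toNNReal) ν')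
    (hUm : Measurable U) (hpq : p ≤ 2 * q) :
    ENNReal.ofReal ((p - q) ^ 2 / (8 * q ^ 2)) ≤ InformationTheory.klDiv ν ν' := by
  have hdp := InformationTheory.klDiv_map_le ν ν' hUm
  rw [hν.map_eq, hν'.map_eq] at hdp
  refine le_trans ?_ hdp
  -- This `θ` maximises `θ p - θ q - 2 θ² q²`, the lower bound left after estimating the logarithm;
  -- `0 ≤ p ≤ 2q` gives `|2θq| ≤ 1/2`.
  set θ : ℝ := (p - q) / (4 * q ^ 2) with hθ
  have hx : 2 * θ * q = (p - q) / (2 * q) := by rw [hθ]; field_simp; ring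
  have hxb : |2 * θ * q| ≤ 1 / 2 := by
    rw [hx, abs_div, abs_of_pos (by positivity : 0 < 2 * q), div_le_iff₀ (by positivity), abs_le]
    constructor <;> linarith
  have hlt : 2 * θ * q < 1 := by linarith [(abs_le.1 hxb).2]
  obtain ⟨hi, he⟩ := integral_exp_mul_sq_gaussianReal hq hlt
  obtain ⟨hi2, he2⟩ := integral_sq_of_hasLaw hp (HasLaw.id (μ := gaussianReal 0 p.toNNReal))
  have h := ofReal_integral_sub_log_le_klDiv (hi2.const_mul θ) hi
  refine le_trans (ENNReal.ofReal_le_ofReal ?_) h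
  simp only [id_eq] at he2 ⊢
  rw [integral_const_mul, he2, he, Real.log_inv, Real.log_sqrt (by linarith)]
  have hlog := neg_sub_sq_le_log_one_sub hxb
  have : θ * p - θ * q - 2 * θ ^ 2 * q ^ 2 = (p - q) ^ 2 / (8 * q ^ 2) := by
    rw [hθ]; field_simp; ring
  nlinarith

end Distances

/-! ### Convexity and asymptotics of the Ornstein–Uhlenbeck variance in its rate. -/

section Variance

variable {t : ℝ}

lemma ouVar_pos (r : ℝ) (ht : 0 < t) : 0 < ouVar r t :=
  intervalIntegral.integral_pos ht (by fun_prop) (fun _ _ => sq_nonneg _)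
    ⟨0, ⟨le_rfl, ht.le⟩, by positivity⟩

/-- The derivative of `ouVar` in the drift coefficient. -/
noncomputable def ouVarDeriv (r t : ℝ) : ℝ :=
  ∫ s in (0 : ℝ)..t, 2 * (t - s) * Real.exp (r * (t - s)) ^ 2

lemma ouVarDeriv_nonneg (r : ℝ) (ht : 0 ≤ t) : 0 ≤ ouVarDeriv r t :=
  intervalIntegral.integral_nonneg ht fun _ hs =>
    mul_nonneg (mul_nonneg zero_le_two (sub_nonneg.2 hs.2)) (sq_nonneg _)

lemma hasDerivAt_ouVar (r t : ℝ) : HasDerivAt (fun r => ouVar r t) (ouVarDeriv r t) r := by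
  have hF' : Continuous fun z : ℝ × ℝ => 2 * (t - z.2) * Real.exp (z.1 * (t - z.2)) ^ 2 := by
    fun_prop
  obtain ⟨C, hC⟩ := ((isCompact_closedBall r 1).prod
    (isCompact_uIcc (a := (0 : ℝ)) (b := t))).exists_bound_of_continuousOn hF'.continuousOn
  refine (intervalIntegral.hasDerivAt_integral_of_dominated_loc_of_deriv_le
    (F := fun r s => Real.exp (r * (t - s)) ^ 2)
    (F' := fun r s => 2 * (t - s) * Real.exp (r * (t - s)) ^ 2) (bound := fun _ => C)
    (Metric.closedBall_mem_nhds r one_pos)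
    (Eventually.of_forall fun x => Continuous.aestronglyMeasurable (by fun_prop))
    (Continuous.intervalIntegrable (by fun_prop) _ _)
    (Continuous.aestronglyMeasurable (by fun_prop))
    (ae_of_all _ fun s hs x hx => hC (x, s) ⟨hx, Set.uIoc_subset_uIcc hs⟩)
    intervalIntegrable_const (ae_of_all _ fun s _ x _ => ?_)).2
  have h : HasDerivAt (fun x => x * (t - s)) (t - s) x := by
    simpa using (hasDerivAt_id x).mul_const (t - s)
  refine (h.exp.pow 2).congr_deriv ?_
  simp
  ring

/-- Strict convexity in the rate: the graph lies strictly above its tangent, by `1 + x < exp x`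
under the integral. -/
lemma mul_ouVarDeriv_lt (a : ℝ) {b : ℝ} (hb : b ≠ 0) (ht : 0 < t) :
    b * ouVarDeriv a t < ouVar (a + b) t - ouVar a t := by
  rw [← sub_pos, ouVar, ouVar, ouVarDeriv, ← intervalIntegral.integral_const_mul,
    ← intervalIntegral.integral_sub (Continuous.intervalIntegrable (by fun_prop) _ _)
      (Continuous.intervalIntegrable (by fun_prop) _ _),
    ← intervalIntegral.integral_sub (Continuous.intervalIntegrable (by fun_prop) _ _)
      (Continuous.intervalIntegrable (by fun_prop) _ _)]
  have hfac : ∀ s, Real.exp ((a + b) * (t - s)) ^ 2 - Real.exp (a * (t - s)) ^ 2 -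
      b * (2 * (t - s) * Real.exp (a * (t - s)) ^ 2) = Real.exp (a * (t - s)) ^ 2 *
        (Real.exp (2 * (b * (t - s))) - (2 * (b * (t - s)) + 1)) := fun s => by
    rw [add_mul, Real.exp_add, two_mul (b * (t - s)), Real.exp_add]
    ring
  simp only [hfac]
  refine intervalIntegral.integral_pos ht (by fun_prop) (fun s _ => ?_) ⟨0, ⟨le_rfl, ht.le⟩, ?_⟩
  · exact mul_nonneg (sq_nonneg _) (sub_nonneg.2 (Real.add_one_le_exp _))
  · refine mul_pos (by positivity) (sub_pos.2 (Real.add_one_lt_exp ?_))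
    simp [hb, ht.ne']

/-- The tangent inequality at the smaller of the two rates, where the derivative is nonnegative,
gives strict monotonicity. -/
lemma ouVar_add_ne (a : ℝ) {b : ℝ} (hb : b ≠ 0) (ht : 0 < t) : ouVar (a + b) t ≠ ouVar a t := by
  rcases hb.lt_or_gt with h | h
  · have h1 := mul_ouVarDeriv_lt (a + b) (neg_ne_zero.2 hb) ht
    have h2 := ouVarDeriv_nonneg (a + b) ht.le
    rw [add_neg_cancel_right] at h1
    nlinarith
  · have h1 := mul_ouVarDeriv_lt a hb ht
    have h2 := ouVarDeriv_nonneg a ht.le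
    nlinarith

/-- Difference quotient at `0` in `x = 1/(n-1)`, corrected by the factor `n/(n-1) → 1`. -/
lemma tendsto_ouVar_sub_div (a b t : ℝ) :
    Tendsto (fun n : ℕ => ouVar (a - b / ((n : ℝ) - 1)) t) atTop (𝓝 (ouVar a t)) ∧
    Tendsto (fun n : ℕ => (n : ℝ) * (ouVar (a - b / ((n : ℝ) - 1)) t - ouVar a t)) atTop
      (𝓝 (-(b * ouVarDeriv a t))) := by
  have hn : Tendsto (fun n : ℕ => (n : ℝ) - 1) atTop atTop :=
    tendsto_atTop_add_const_right _ _ tendsto_natCast_atTop_atTop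
  have hinv := tendsto_inv_atTop_nhdsGT_zero.comp hn
  have hd : HasDerivAt (fun x => ouVar (a - b * x) t) (ouVarDeriv a t * -b) 0 := by
    have h1 : HasDerivAt (fun x => a - b * x) (-b) 0 := by
      simpa using ((hasDerivAt_id (0 : ℝ)).const_mul b).const_sub a
    exact HasDerivAt.comp (h₂ := fun r => ouVar r t) (0 : ℝ)
      (by simpa using hasDerivAt_ouVar a t) h1
  constructor
  · have := hd.continuousAt.tendsto.comp (hinv.mono_right nhdsWithin_le_nhds)
    simpa [Function.comp_def, div_eq_mul_inv] using this
  · have h1 := hd.tendsto_slope_zero_right.comp hinv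
    have h2 : Tendsto (fun n : ℕ => 1 + ((n : ℝ) - 1)⁻¹) atTop (𝓝 1) := by
      simpa using (hinv.mono_right nhdsWithin_le_nhds).const_add 1
    have h3 := h2.mul h1
    rw [one_mul, mul_neg, mul_comm (ouVarDeriv a t)] at h3
    refine h3.congr' ?_
    filter_upwards [eventually_gt_atTop 1] with n hn1
    have hn0 : (n : ℝ) - 1 ≠ 0 := by
      have : (1 : ℝ) < n := by exact_mod_cast hn1
      linarith
    simp only [Function.comp_apply, inv_inv, zero_add, mul_zero, sub_zero, smul_eq_mul,
      ← div_eq_mul_inv]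
    field_simp
    ring

end Variance

/-! ### Choice of the test vector. -/

/-- For `κ ≥ 2`, `p` is the difference of `p + e/κ` and `e/κ`, so both cannot be below `|D|/4`. For
`κ = 1` no second vector is available and the bound on `p + e` is used. -/
lemma exists_lower_bound {p e D β κ m : ℝ} (hm : m ≤ (D - β) / 2) (hm' : m ≤ |D| / 4)
    (hpe : (D - β) / 2 < p + e) (hp : |D| / 2 < |p|) (hκ : κ = 1 ∨ 2 ≤ κ) :
    m ≤ |p + e / κ| ∨ (2 ≤ κ ∧ m ≤ |e / κ|) := by
  rcases hκ with rfl | hκ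
  · left
    rw [div_one]
    exact (hm.trans hpe.le).trans (le_abs_self _)
  · by_contra! h
    have h1 := abs_sub (p + e / κ) (e / κ)
    rw [add_sub_cancel_right] at h1
    linarith [h.2 hκ, h.1]

/-- The limiting discrepancy of variances is attained, up to a constant factor, by one of the
functionals `k^{-1/2} ∑ xᵢ` and `2^{-1/2} (x₁ - x₂)`. -/
lemma exists_unit_vector_discrepancy {a b t : ℝ} (hb : b ≠ 0) (ht : 0 < t) {k : ℕ → ℕ}
    (hk1 : ∀ n, 2 ≤ n → 1 ≤ k n) (hkn : ∀ n, k n ≤ n)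
    (hk : Tendsto (fun n : ℕ => (k n : ℝ) / n) atTop (𝓝 0)) :
    ∃ C > 0, ∀ᶠ n : ℕ in atTop, 2 ≤ n ∧ ∃ c : Fin (k n) → ℝ, ∑ i, c i ^ 2 = 1 ∧ ∃ s : ℝ,
      s = (∑ i, c i) ^ 2 / n * ouVar (a + b) t +
        (∑ i, c i ^ 2 - (∑ i, c i) ^ 2 / n) * ouVar (a - b / (n - 1)) t ∧
      0 ≤ s ∧ s ≤ 2 * ouVar a t ∧ C ≤ ((n : ℝ) / k n) ^ 2 * (s - ouVar a t) ^ 2 := by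
  obtain ⟨hv2, hE⟩ := tendsto_ouVar_sub_div a b t
  have hv0 := ouVar_pos a ht
  set v₁ := ouVar (a + b) t with hv₁
  set v₀ := ouVar a t with hv₀
  set β := b * ouVarDeriv a t with hβ
  have hDβ : 0 < v₁ - v₀ - β := sub_pos.2 (mul_ouVarDeriv_lt a hb ht)
  have hD : 0 < |v₁ - v₀| := abs_pos.2 (sub_ne_zero.2 (ouVar_add_ne a hb ht))
  set m := min ((v₁ - v₀ - β) / 2) (|v₁ - v₀| / 4) with hm
  have hm0 : 0 < m := lt_min (by positivity) (by positivity)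
  have hp := hv2.const_sub v₁
  -- Here `k/n → 0` enters: the test variance tends to `v₀`, so eventually it is at most `2 v₀`, as
  -- the distance bounds require.
  have hs1 : Tendsto (fun n : ℕ => (k n : ℝ) / n * v₁ +
      (1 - (k n : ℝ) / n) * ouVar (a - b / ((n : ℝ) - 1)) t) atTop (𝓝 v₀) := by
    simpa using (hk.mul_const v₁).add ((hk.const_sub 1).mul hv2)
  refine ⟨m ^ 2, by positivity, ?_⟩
  filter_upwards [eventually_ge_atTop 2,
    (hp.add hE).eventually_const_lt (u := (v₁ - v₀ - β) / 2) (by linarith),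
    hp.abs.eventually_const_lt (u := |v₁ - v₀| / 2) (by linarith),
    hs1.eventually_lt_const (u := 2 * v₀) (by linarith),
    hv2.eventually_lt_const (u := 2 * v₀) (by linarith)] with n hn h1 h2 h3 h4
  refine ⟨hn, ?_⟩
  have hκ1 := hk1 n hn
  have hκn := hkn n
  set κ := k n with hκ
  have hκ0 : (0 : ℝ) < κ := by exact_mod_cast hκ1
  have hn0 : (0 : ℝ) < n := by exact_mod_cast (by omega : 0 < n)
  have hle1 : (κ : ℝ) / n ≤ 1 := by
    rw [div_le_one hn0]
    exact_mod_cast hκn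
  have hv1nn := ouVar_nonneg (a + b) ht.le
  have hv2nn := ouVar_nonneg (a - b / ((n : ℝ) - 1)) ht.le
  set v₂ := ouVar (a - b / ((n : ℝ) - 1)) t with hv₂
  have hκc : (κ : ℝ) = 1 ∨ 2 ≤ (κ : ℝ) := by
    rcases (show κ = 1 ∨ 2 ≤ κ by omega) with h | h
    · left; exact_mod_cast h
    · right; exact_mod_cast h
  -- Applied with `p = v₁ - v₂` and `e = n (v₂ - v₀)`: the rescaled gap `(n/κ)(s - v₀)` is `p + e/κ`
  -- for the normalised all-ones vector and `e/κ` for a vector of zero sum.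
  rcases exists_lower_bound (κ := κ) (min_le_left _ _) (min_le_right _ _) h1 h2 hκc with h | ⟨h2κ, h⟩
  · have hsq : ((√κ)⁻¹) ^ 2 = (κ : ℝ)⁻¹ := by rw [inv_pow, Real.sq_sqrt hκ0.le]
    have hc2 : ∑ _i : Fin κ, ((√κ)⁻¹) ^ 2 = (1 : ℝ) := by
      simp [hκ0.ne']
    have hc1 : (∑ _i : Fin κ, (√κ)⁻¹) ^ 2 = (κ : ℝ) := by
      simp only [Finset.sum_const, Finset.card_univ, Fintype.card_fin, nsmul_eq_mul, mul_pow, hsq]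
      field_simp
    refine ⟨fun _ => (√κ)⁻¹, hc2, _, rfl, ?_⟩
    rw [hc2, hc1]
    refine ⟨add_nonneg (by positivity) (mul_nonneg (by linarith) hv2nn), h3.le, ?_⟩
    rw [← mul_pow, ← sq_abs ((n : ℝ) / κ * _)]
    refine pow_le_pow_left₀ hm0.le (h.trans (le_of_eq ?_)) 2
    congr 1
    field_simp
    ring
  · have h2κ' : 2 ≤ κ := by exact_mod_cast h2κ
    let i₀ : Fin κ := ⟨0, by omega⟩
    let i₁ : Fin κ := ⟨1, by omega⟩
    have hne : i₁ ≠ i₀ := by simp [i₀, i₁]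
    have hsq : ((√2)⁻¹) ^ 2 = (2 : ℝ)⁻¹ := by rw [inv_pow, Real.sq_sqrt zero_le_two]
    -- Zero sum removes the mean mode, so the test variance is exactly `v₂`.
    let c : Fin κ → ℝ := fun i => if i = i₀ then (√2)⁻¹ else if i = i₁ then -(√2)⁻¹ else 0
    have hval : ∀ φ : ℝ → ℝ, φ 0 = 0 → ∑ i, φ (c i) = φ (√2)⁻¹ + φ (-(√2)⁻¹) := fun φ hφ => by
      rw [Fintype.sum_eq_add i₀ i₁ hne.symm]
      · simp [c, hne]
      · rintro i ⟨h0, h1⟩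
        simp [c, h0, h1, hφ]
    have hc2 : ∑ i, c i ^ 2 = 1 := by
      rw [hval (fun x => x ^ 2) (by simp)]
      simp only [neg_sq, hsq]
      norm_num
    have hc1 : ∑ i, c i = 0 := by
      rw [hval (fun x => x) rfl]
      ring
    refine ⟨c, hc2, _, rfl, ?_⟩
    rw [hc2, hc1]
    have hs : (0 : ℝ) ^ 2 / n * v₁ + (1 - 0 ^ 2 / n) * v₂ = v₂ := by simp
    rw [hs]
    refine ⟨hv2nn, h4.le, ?_⟩
    rw [← mul_pow, ← sq_abs ((n : ℝ) / κ * _)]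
    refine pow_le_pow_left₀ hm0.le (h.trans (le_of_eq ?_)) 2
    congr 1
    field_simp

/-! ### The test functional on configurations and paths. -/

section Functional

variable {d k n : ℕ} {T : ℝ} {a b : ℝ}

/-- Cauchy–Schwarz with the unit vector `c`, then a single coordinate is bounded by the Euclidean
norm. -/
lemma ofReal_abs_sum_mul_sub_le_configDist {c : Fin k → ℝ} (hc : ∑ i, c i ^ 2 = 1) (j : Fin d)
    (x y : Fin k → EuclideanSpace ℝ (Fin d)) :
    ENNReal.ofReal |∑ i, c i * x i j - ∑ i, c i * y i j| ≤ configDist x y := by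
  rw [configDist, edist_dist]
  refine ENNReal.ofReal_le_ofReal (abs_le_of_sq_le_sq ?_ dist_nonneg)
  rw [PiLp.dist_eq_of_L2, Real.sq_sqrt (Finset.sum_nonneg fun i _ => sq_nonneg _),
    ← Finset.sum_sub_distrib]
  simp only [← mul_sub]
  refine (Finset.sum_mul_sq_le_sq_mul_sq _ _ _).trans ?_
  rw [hc, one_mul]
  refine Finset.sum_le_sum fun i _ => ?_
  rw [← sq_abs, dist_eq_norm]
  exact pow_le_pow_left₀ (abs_nonneg _) (PiLp.norm_apply_le (x i - y i) j) 2

lemma ofReal_abs_sum_mul_sub_le_pathDist {c : Fin k → ℝ} (hc : ∑ i, c i ^ 2 = 1) (j : Fin d)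
    (t : Set.Icc (0 : ℝ) T) (x y : Fin k → PathSpace d T) :
    ENNReal.ofReal |∑ i, c i * x i t j - ∑ i, c i * y i t j| ≤ pathDist x y :=
  (ofReal_abs_sum_mul_sub_le_configDist hc j _ _).trans
    (le_iSup (fun t => configDist (fun i => x i t) fun i => y i t) t)

lemma measurable_sum_mul_eval (t : Set.Icc (0 : ℝ) T) (j : Fin d) (c : Fin k → ℝ) :
    Measurable fun x : Fin k → PathSpace d T => ∑ i, c i * x i t j :=
  Finset.measurable_fun_sum _ fun i _ =>
    ((measurable_eval_coord t j).comp (measurable_pi_apply i)).const_mul _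

lemma measurable_eval_pi (t : Set.Icc (0 : ℝ) T) :
    Measurable fun (x : Fin k → PathSpace d T) (i : Fin k) => x i t :=
  measurable_pi_iff.2 fun i => (continuous_eval_const t).measurable.comp (measurable_pi_apply i)

lemma measurable_castLE {α : Type*} [MeasurableSpace α] (h : k ≤ n) :
    Measurable fun (x : Fin n → α) (i : Fin k) => x (Fin.castLE h i) :=
  measurable_pi_iff.2 fun _ => measurable_pi_apply _

lemma hasLaw_map_of_comp {α β γ : Type*} [MeasurableSpace α] [MeasurableSpace β]
    [MeasurableSpace γ] {Q : Measure α} {G : Measure γ} {φ : α → β} {f : β → γ}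
    (hφ : Measurable φ) (hf : Measurable f) (h : HasLaw (fun x => f (φ x)) G Q) :
    HasLaw f G (Q.map φ) :=
  ⟨hf.aemeasurable, by rw [Measure.map_map hf hφ]; exact h.map_eq⟩

/-- Extending `c` by zero to all `n` particles changes neither `∑ c` nor `∑ c²`. -/
theorem IsParticleLaw.hasLaw_firstMarginal (hn : 2 ≤ n) (hT : 0 < T)
    {P : Measure (Fin n → PathSpace d T)}
    (hP : IsParticleLaw.{u} (fun t x => a • x t) (fun t _ y => b • y t) P)
    (hP0 : timeMarginal ⟨0, le_rfl, hT.le⟩ P = Measure.dirac 0)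
    (h : k ≤ n) (t : Set.Icc (0 : ℝ) T) (j : Fin d) (c : Fin k → ℝ) :
    HasLaw (fun x : Fin k → PathSpace d T => ∑ i, c i * x i t j)
      (gaussianReal 0 (Real.toNNReal ((∑ i, c i) ^ 2 / n * ouVar (a + b) t +
        (∑ i, c i ^ 2 - (∑ i, c i) ^ 2 / n) * ouVar (a - b / (n - 1)) t))) (firstMarginal h P) := by
  let c' : Fin n → ℝ := Function.extend (Fin.castLE h) c 0
  have hinj := Fin.castLE_injective h
  have hc' : ∀ i, c' (Fin.castLE h i) = c i := fun i => hinj.extend_apply _ _ _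
  have hc0 : ∀ i ∉ Set.range (Fin.castLE h), c' i = 0 := fun i hi =>
    Function.extend_apply' _ _ _ hi
  have h1 : ∑ i, c i = ∑ i, c' i :=
    Fintype.sum_of_injective _ hinj _ _ hc0 fun i => (hc' i).symm
  have h2 : ∑ i, c i ^ 2 = ∑ i, c' i ^ 2 :=
    Fintype.sum_of_injective _ hinj _ _ (fun i hi => by simp [hc0 i hi]) fun i => by rw [hc']
  rw [h1, h2]
  refine hasLaw_map_of_comp (measurable_castLE h) (measurable_sum_mul_eval t j c) ?_
  refine (hP.hasLaw_sum_mul hn hT hP0 t j c').congr (ae_of_all _ fun x => ?_)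
  exact Fintype.sum_of_injective _ hinj _ _ (fun i hi => by simp [hc0 i hi]) fun i => by rw [hc']

lemma IsParticleLaw.isProbabilityMeasure
    {b₀ : Set.Icc (0 : ℝ) T → PathSpace d T → EuclideanSpace ℝ (Fin d)}
    {b₁ : Set.Icc (0 : ℝ) T → PathSpace d T → PathSpace d T → EuclideanSpace ℝ (Fin d)}
    {P : Measure (Fin n → PathSpace d T)} (hP : IsParticleLaw.{u} b₀ b₁ P) :
    IsProbabilityMeasure P := by
  obtain ⟨Ω, mΩ, Pr, 𝓕, X, W, hPr, -, -, hlaw⟩ := hP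
  exact hlaw.isProbabilityMeasure_iff.1 hPr

lemma IsMcKeanVlasovLaw.isProbabilityMeasure
    {b₀ : Set.Icc (0 : ℝ) T → PathSpace d T → EuclideanSpace ℝ (Fin d)}
    {b₁ : Set.Icc (0 : ℝ) T → PathSpace d T → PathSpace d T → EuclideanSpace ℝ (Fin d)}
    {μ : Measure (PathSpace d T)} (hμ : IsMcKeanVlasovLaw.{v} b₀ b₁ μ) :
    IsProbabilityMeasure μ := by
  obtain ⟨Ω, mΩ, Pr, 𝓕, X, W, hPr, -, -, hlaw⟩ := hμ
  exact hlaw.isProbabilityMeasure_iff.1 hPr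

end Functional

lemma liminf_pos_of_eventually_le {k : ℕ → ℕ} {F : ℕ → ℝ≥0∞} {C K : ℝ} (hC : 0 < C) (hK : 0 < K)
    (h : ∀ᶠ n : ℕ in atTop, ∃ x : ℝ, C ≤ ((n : ℝ) / k n) ^ 2 * x ∧ ENNReal.ofReal (x / K) ≤ F n) :
    0 < liminf (fun n : ℕ => ENNReal.ofReal (((n : ℝ) / k n) ^ 2) * F n) atTop := by
  refine lt_of_lt_of_le (ENNReal.ofReal_pos.2 (div_pos hC hK)) (le_liminf_of_le (by isBoundedDefault) ?_)
  filter_upwards [h] with n ⟨x, hx, hF⟩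
  refine le_trans ?_ (mul_le_mul_right hF _)
  rw [← ENNReal.ofReal_mul (sq_nonneg _)]
  refine ENNReal.ofReal_le_ofReal ?_
  rw [← mul_div_assoc]
  exact div_le_div_of_nonneg_right hx hK.le

end MeanField

/-! ### The main theorem. -/

open MeanField

theorem mainTheorem9 (d : ℕ) (hd : 1 ≤ d) (T : ℝ) (hT : 0 < T) (a b : ℝ) (hb : b ≠ 0)
    -- the laws of the `n`-particle systems with `b₀(t,x) = a x_t`, `b(t,x,y) = b y_t`, started at 0
    (P : (n : ℕ) → Measure (Fin n → MeanField.PathSpace d T))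
    (hP : ∀ n, 2 ≤ n →
      MeanField.IsParticleLaw.{u} (fun t x => a • x t) (fun t _ y => b • y t) (P n))
    (hP0 : ∀ n, 2 ≤ n →
      MeanField.timeMarginal ⟨0, le_rfl, hT.le⟩ (P n) = Measure.dirac 0)
    -- the law of the McKean–Vlasov equation with the same coefficients, started at 0
    (μ : Measure (MeanField.PathSpace d T))
    (hμ : MeanField.IsMcKeanVlasovLaw.{v} (fun t x => a • x t) (fun t _ y => b • y t) μ)
    (hμ0 : μ.map (fun x => x ⟨0, le_rfl, hT.le⟩) = Measure.dirac 0)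
    (k : ℕ → ℕ) (hk1 : ∀ n, 2 ≤ n → 1 ≤ k n) (hkn : ∀ n, k n ≤ n)
    (hk : Tendsto (fun n : ℕ => (k n : ℝ) / n) atTop (𝓝 0)) :
    (∀ t : Set.Icc (0 : ℝ) T, 0 < (t : ℝ) →
      0 < liminf (fun n : ℕ => ENNReal.ofReal (((n : ℝ) / k n) ^ 2) *
        MeanField.wassersteinSq MeanField.configDist
          (MeanField.timeMarginal t (MeanField.firstMarginal (hkn n) (P n)))
          (Measure.pi fun _ : Fin (k n) => μ.map fun x => x t)) atTop) ∧
    0 < liminf (fun n : ℕ => ENNReal.ofReal (((n : ℝ) / k n) ^ 2) *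
      MeanField.wassersteinSq MeanField.pathDist
        (MeanField.firstMarginal (hkn n) (P n))
        (Measure.pi fun _ : Fin (k n) => μ)) atTop ∧
    0 < liminf (fun n : ℕ => ENNReal.ofReal (((n : ℝ) / k n) ^ 2) *
      InformationTheory.klDiv
        (MeanField.firstMarginal (hkn n) (P n))
        (Measure.pi fun _ : Fin (k n) => μ)) atTop := by
  have hμp := hμ.isProbabilityMeasure
  obtain ⟨j⟩ : Nonempty (Fin d) := ⟨⟨0, hd⟩⟩
  have hμlaw : ∀ t : Set.Icc (0 : ℝ) T, HasLaw (fun x : PathSpace d T => x t j)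
      (gaussianReal 0 (ouVar a t).toNNReal) μ := fun t => hμ.hasLaw_eval hT hμ0 t j
  refine ⟨fun t ht => ?_, ?_⟩
  · obtain ⟨C, hC, hev⟩ := exists_unit_vector_discrepancy (a := a) hb ht hk1 hkn hk
    have hv := ouVar_pos a ht
    refine liminf_pos_of_eventually_le hC (mul_pos (by norm_num : (0 : ℝ) < 6) hv) ?_
    filter_upwards [hev] with n ⟨hn, c, hc, s, hs, hs0, hs2, hCs⟩
    have h1 : HasLaw (fun x : Fin (k n) → EuclideanSpace ℝ (Fin d) => ∑ i, c i * x i j)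
        (gaussianReal 0 s.toNNReal) (timeMarginal t (firstMarginal (hkn n) (P n))) := by
      refine hasLaw_map_of_comp (measurable_eval_pi t) (by fun_prop) ?_
      rw [hs]
      exact (hP n hn).hasLaw_firstMarginal hn hT (hP0 n hn) (hkn n) t j c
    have hev : Measurable fun x : PathSpace d T => x t := (continuous_eval_const t).measurable
    have : IsProbabilityMeasure (μ.map fun x : PathSpace d T => x t) :=
      Measure.isProbabilityMeasure_map hev.aemeasurable
    have h2 := hasLaw_sum_mul_pi (ι := Fin (k n)) hv.le
      (hasLaw_map_of_comp (f := fun x : EuclideanSpace ℝ (Fin d) => x j) hev (by fun_prop)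
        (hμlaw t)) c
    rw [hc, one_mul] at h2
    exact ⟨_, hCs, ofReal_le_wassersteinSq
      (fun x y => ofReal_abs_sum_mul_sub_le_configDist hc j x y) hs0 hv h1 h2 hs2⟩
  -- For path laws one positive time suffices, since evaluation there is controlled by the
  -- sup-distance and by data processing.
  · obtain ⟨t, ht⟩ : ∃ t : Set.Icc (0 : ℝ) T, 0 < (t : ℝ) := ⟨⟨T, hT.le, le_rfl⟩, hT⟩
    obtain ⟨C, hC, hev⟩ := exists_unit_vector_discrepancy (a := a) hb ht hk1 hkn hk
    have hv := ouVar_pos a ht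
    constructor
    · refine liminf_pos_of_eventually_le hC (mul_pos (by norm_num : (0 : ℝ) < 6) hv) ?_
      filter_upwards [hev] with n ⟨hn, c, hc, s, hs, hs0, hs2, hCs⟩
      have h1 := (hP n hn).hasLaw_firstMarginal hn hT (hP0 n hn) (hkn n) t j c
      have h2 := hasLaw_sum_mul_pi (ι := Fin (k n)) hv.le (hμlaw t) c
      rw [← hs] at h1
      rw [hc, one_mul] at h2
      exact ⟨_, hCs, ofReal_le_wassersteinSq
        (fun x y => ofReal_abs_sum_mul_sub_le_pathDist hc j t x y) hs0 hv h1 h2 hs2⟩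
    · refine liminf_pos_of_eventually_le hC (mul_pos (by norm_num : (0 : ℝ) < 8) (pow_pos hv 2)) ?_
      filter_upwards [hev] with n ⟨hn, c, hc, s, hs, hs0, hs2, hCs⟩
      have h1 := (hP n hn).hasLaw_firstMarginal hn hT (hP0 n hn) (hkn n) t j c
      have h2 := hasLaw_sum_mul_pi (ι := Fin (k n)) hv.le (hμlaw t) c
      rw [← hs] at h1
      rw [hc, one_mul] at h2
      have := (hP n hn).isProbabilityMeasure
      have : IsProbabilityMeasure (firstMarginal (hkn n) (P n)) :=
        Measure.isProbabilityMeasure_map (measurable_castLE (hkn n)).aemeasurable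
      exact ⟨_, hCs, ofReal_le_klDiv hs0 hv h1 h2 (measurable_sum_mul_eval t j c) hs2⟩
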